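/- Throughout, "meromorphic" means meromorphic in the complex plane $\mathbb{C}$, and the order of a meromorphic function $f$ is $\rho(f)=\limsup_{r\to\infty}\frac{\log^+T(r,f)}{\log r}$, where $T(r,f)$ is the Nevanlinna characteristic. (i) Let $R_1,R_2$ be rational functions with $R_1\not\equiv 0$ and let $q$ be a polynomial. If the equation $$F'=R_1e^{q}F+R_2$$ has a nonconstant meromorphic solution $F$ of finite order, then $q$ is constant. (ii) Let $N$ be the class of meromorphic functions $f$ of finite order such that $f$ has only finitely many poles, $f'$ has only finitely many multiple zeros, and, with finitely many exceptions, every fixed point of $f$ is superattracting (i.e. is also a zero of $f'$) and every zero of $f'$ is a superattracting fixed point of $f$. Then every $f\in N$ satisfies $$f'(z)=\frac{q_1(z)}{q_2(z)}\,(f(z)-z)$$ for some polynomials $q_1,q_2\not\equiv0$. Moreover, whenever $f\in N$ satisfies $f'(z)=\frac{q_1(z)}{q_2(z)}e^{q_3(z)}(f(z)-z)$ with polynomials $q_1$, $q_2\not\equiv 0$ and $q_3$, the polynomial $q_3$ is constant. -/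

import Mathlib

/-- The order of growth `ρ(f) = limsup_{r → ∞} log⁺ T(r, f) / log r` of a meromorphic function
`f` on the complex plane, where `T(r, f)` is the Nevanlinna characteristic of `f`. -/
noncomputable def growthOrder (f : ℂ → ℂ) : EReal :=
  Filter.limsup
    (fun r : ℝ => ((Real.posLog (ValueDistribution.characteristic f ⊤ r) / Real.log r : ℝ) : EReal))
    Filter.atTop

/-- `f` has finite order of growth. -/
def HasFiniteOrder (f : ℂ → ℂ) : Prop := growthOrder f < ⊤

/-- Equality as meromorphic functions: `f` and `g` agree off a closed discrete set (so the
values that Lean assigns at poles and removable singularities play no role). -/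
def MerEq (f g : ℂ → ℂ) : Prop := f =ᶠ[Filter.codiscrete ℂ] g

/-- `z` is a pole of the meromorphic function `f`. -/
def IsPoleOf (f : ℂ → ℂ) (z : ℂ) : Prop := meromorphicOrderAt f z < 0

/-- `z` is a zero of the meromorphic function `f`. -/
def IsZeroOf (f : ℂ → ℂ) (z : ℂ) : Prop := 0 < meromorphicOrderAt f z

/-- `z` is a multiple zero of the meromorphic function `f`. -/
def IsMultipleZeroOf (f : ℂ → ℂ) (z : ℂ) : Prop := 2 ≤ meromorphicOrderAt f z

/-- `z` is a fixed point of the meromorphic function `f`: a zero of `f(w) - w`. -/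
def IsFixedPointOf (f : ℂ → ℂ) (z : ℂ) : Prop := IsZeroOf (fun w => f w - w) z

/-- `z` is a superattracting fixed point of `f`: `f(z) = z` and `f'(z) = 0`. -/
def IsSuperattracting (f : ℂ → ℂ) (z : ℂ) : Prop := IsFixedPointOf f z ∧ IsZeroOf (deriv f) z

/-- The class `N` of Baker and Bergweiler. -/
structure InClassN (f : ℂ → ℂ) : Prop where
  meromorphic : Meromorphic f
  finite_poles : {z | IsPoleOf f z}.Finite
  finite_multiple_zeros : {z | IsMultipleZeroOf (deriv f) z}.Finite
  /-- With finitely many exceptions, the fixed points are zeros of `f'`. -/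
  fixed_superattracting : {z | IsFixedPointOf f z ∧ ¬ IsSuperattracting f z}.Finite
  /-- With finitely many exceptions, the zeros of `f'` are fixed points. -/
  zeros_superattracting : {z | IsZeroOf (deriv f) z ∧ ¬ IsSuperattracting f z}.Finite
  finite_order : HasFiniteOrder f

open Filter Topology Metric Set ValueDistribution
open scoped Polynomial

/-! Both claims reduce to one fact, `HasExpGrowth.eq_zero_of_deriv_eq`: for nonconstant `q`, `N ≠ 0`
and `deg E < deg D`, the equation `D G' = (E + N e^q) G + S` with polynomial coefficients has only
the zero solution among entire functions of finite order. In directions where `Re q → +∞`, `G'`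
would have to be enormously larger than `G`; iterated Cauchy estimates against the finite order of
`G` leave only `|G| ≤ 2`. In directions where `Re q → -∞`, the coefficient of `G` is `O(1/r)` after
division by `D`, and Grönwall in `log r` gives polynomial growth. These directions are dense, so
Phragmén–Lindelöf makes `G` a polynomial; then `N e^q G` has polynomial growth, which forces `G =
0`.

For (i), poles of `F` lie over poles of the coefficients, so `F = G / P` with `P` a polynomial and
`G` entire of finite order, and `G` solves such an equation. The passage from the Nevanlinna
characteristic to the maximum modulus is the Poisson–Jensen inequality.

For (ii), `f'` and `f - z` have equal orders off a finite set, so `f' / (f - z)` is a rational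
function times a zero-free entire `K`. Being a quotient of functions of finite order, `K` is
`e^{q₃}` with `q₃` a polynomial. Now `F = f - z` solves `F' = R e^{q₃} F - 1`, and the argument of
(i) makes `q₃` constant. -/

/-! ### Entire functions of finite order, measured by maximum modulus -/

/-- An entire function of finite order: `‖G z‖ ≤ exp (A * (1 + ‖z‖) ^ m)` for all `z`. -/
def HasExpGrowth (G : ℂ → ℂ) : Prop :=
  Differentiable ℂ G ∧ ∃ A : ℝ, 0 ≤ A ∧ ∃ m : ℕ, ∀ z, ‖G z‖ ≤ Real.exp (A * (1 + ‖z‖) ^ m)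

theorem Polynomial.exists_norm_eval_le (p : ℂ[X]) :
    ∃ C : ℝ, 0 ≤ C ∧ ∃ k : ℕ, ∀ z : ℂ, ‖p.eval z‖ ≤ C * (1 + ‖z‖) ^ k := by
  refine ⟨∑ i ∈ Finset.range (p.natDegree + 1), ‖p.coeff i‖, by positivity, p.natDegree,
    fun z => ?_⟩
  rw [Polynomial.eval_eq_sum_range, Finset.sum_mul]
  refine (norm_sum_le _ _).trans (Finset.sum_le_sum fun i hi => ?_)
  rw [norm_mul, norm_pow]
  have h1 : (1 : ℝ) ≤ 1 + ‖z‖ := by linarith [norm_nonneg z]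
  have : ‖z‖ ^ i ≤ (1 + ‖z‖) ^ p.natDegree :=
    (pow_le_pow_left₀ (norm_nonneg z) (by linarith) i).trans
      (pow_le_pow_right₀ h1 (by simp at hi; omega))
  gcongr

theorem HasExpGrowth.mul {G H : ℂ → ℂ} (hG : HasExpGrowth G) (hH : HasExpGrowth H) :
    HasExpGrowth (fun z => G z * H z) := by
  obtain ⟨dG, A, hA, m, hm⟩ := hG
  obtain ⟨dH, B, hB, n, hn⟩ := hH
  refine ⟨dG.mul dH, A + B, by positivity, m + n, fun z => ?_⟩
  have h1 : (1 : ℝ) ≤ 1 + ‖z‖ := by linarith [norm_nonneg z]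
  calc ‖G z * H z‖ ≤ Real.exp (A * (1 + ‖z‖) ^ m) * Real.exp (B * (1 + ‖z‖) ^ n) := by
        rw [norm_mul]; exact mul_le_mul (hm z) (hn z) (norm_nonneg _) (Real.exp_pos _).le
    _ ≤ Real.exp ((A + B) * (1 + ‖z‖) ^ (m + n)) := by
        rw [← Real.exp_add, Real.exp_le_exp, add_mul]
        gcongr <;> omega

theorem HasExpGrowth.sub {G H : ℂ → ℂ} (hG : HasExpGrowth G) (hH : HasExpGrowth H) :
    HasExpGrowth (fun z => G z - H z) := by
  obtain ⟨dG, A, hA, m, hm⟩ := hG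
  obtain ⟨dH, B, hB, n, hn⟩ := hH
  -- The summand `1` absorbs the factor `2` from the triangle inequality, since `2 ≤ e`.
  refine ⟨dG.sub dH, 1 + A + B, by positivity, m + n, fun z => ?_⟩
  have h1 : (1 : ℝ) ≤ 1 + ‖z‖ := by linarith [norm_nonneg z]
  have h2 : (1 : ℝ) ≤ (1 + ‖z‖) ^ (m + n) := one_le_pow₀ h1
  have hGz : ‖G z‖ ≤ Real.exp ((A + B) * (1 + ‖z‖) ^ (m + n)) :=
    (hm z).trans <| Real.exp_le_exp.2 <| mul_le_mul (by linarith)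
      (pow_le_pow_right₀ h1 (by omega)) (by positivity) (by positivity)
  have hHz : ‖H z‖ ≤ Real.exp ((A + B) * (1 + ‖z‖) ^ (m + n)) :=
    (hn z).trans <| Real.exp_le_exp.2 <| mul_le_mul (by linarith)
      (pow_le_pow_right₀ h1 (by omega)) (by positivity) (by positivity)
  calc ‖G z - H z‖ ≤ ‖G z‖ + ‖H z‖ := norm_sub_le _ _
    _ ≤ 2 * Real.exp ((A + B) * (1 + ‖z‖) ^ (m + n)) := by linarith
    _ ≤ Real.exp 1 * Real.exp ((A + B) * (1 + ‖z‖) ^ (m + n)) := by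
        gcongr; linarith [Real.add_one_le_exp (1 : ℝ)]
    _ ≤ Real.exp ((1 + A + B) * (1 + ‖z‖) ^ (m + n)) := by
        rw [← Real.exp_add, Real.exp_le_exp]; nlinarith

theorem Polynomial.hasExpGrowth (p : ℂ[X]) : HasExpGrowth (fun z => p.eval z) := by
  obtain ⟨C, hC, k, hk⟩ := p.exists_norm_eval_le
  refine ⟨p.differentiable, C + k, by positivity, k + 1, fun z => (hk z).trans ?_⟩
  have h1 : (1 : ℝ) ≤ 1 + ‖z‖ := by linarith [norm_nonneg z]
  have h2 : (1 : ℝ) ≤ (1 + ‖z‖) ^ k := one_le_pow₀ h1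
  calc C * (1 + ‖z‖) ^ k ≤ Real.exp C * Real.exp (‖z‖) ^ k := by
        gcongr
        · linarith [Real.add_one_le_exp C]
        · linarith [Real.add_one_le_exp ‖z‖]
    _ = Real.exp (C + k * ‖z‖) := by rw [Real.exp_add, Real.exp_nat_mul]
    _ ≤ Real.exp ((C + k) * (1 + ‖z‖) ^ (k + 1)) := by
        rw [Real.exp_le_exp, pow_succ]
        have h3 : 1 + ‖z‖ ≤ (1 + ‖z‖) ^ k * (1 + ‖z‖) := by nlinarith
        have : (0 : ℝ) ≤ k := by positivity
        nlinarith [norm_nonneg z]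

/-- Cauchy's estimate on the unit circle about `z`, where `1 + ‖w‖ ≤ 2 (1 + ‖z‖)`; hence the factor
`2 ^ m`. -/
protected theorem HasExpGrowth.deriv {G : ℂ → ℂ} (hG : HasExpGrowth G) : HasExpGrowth (deriv G) := by
  obtain ⟨dG, A, hA, m, hm⟩ := hG
  refine ⟨dG.contDiff.differentiable_deriv_two, A * 2 ^ m, by positivity, m, fun z => ?_⟩
  have := Complex.norm_deriv_le_of_forall_mem_sphere_norm_le (f := G) (c := z) (R := 1)
    (C := Real.exp (A * 2 ^ m * (1 + ‖z‖) ^ m)) one_pos dG.diffContOnCl fun w hw => by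
      refine (hm w).trans (Real.exp_le_exp.2 ?_)
      rw [mul_assoc, ← mul_pow]
      have : ‖w‖ ≤ ‖z‖ + 1 := by
        have h := norm_le_norm_add_norm_sub' w z
        rw [mem_sphere_iff_norm.1 hw] at h
        exact h
      gcongr
      linarith [norm_nonneg z]
  simpa using this

/-- An entire function of polynomial growth is a polynomial. -/
theorem Differentiable.exists_polynomial_of_norm_le {G : ℂ → ℂ} (hG : Differentiable ℂ G)
    {C : ℝ} {k : ℕ} (h : ∀ z, ‖G z‖ ≤ C * (1 + ‖z‖) ^ k) : ∃ p : ℂ[X], ∀ z, G z = p.eval z := by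
  have hC : 0 ≤ C := by simpa using (norm_nonneg _).trans (h 0)
  have hder : ∀ n, k < n → iteratedDeriv n G 0 = 0 := by
    intro n hn
    have hb : ∀ R : ℝ, 1 ≤ R → ‖iteratedDeriv n G 0‖ ≤ n.factorial * (C * 2 ^ k) * R⁻¹ := by
      intro R hR
      have hR0 : 0 < R := by linarith
      refine (Complex.norm_iteratedDeriv_le_of_forall_mem_sphere_norm_le n hR0
        hG.diffContOnCl (C := C * (2 ^ k * R ^ k)) fun z hz => ?_).trans ?_
      · refine (h z).trans ?_
        rw [mem_sphere_zero_iff_norm.1 hz, ← mul_pow]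
        gcongr
        linarith
      · rw [div_le_iff₀ (by positivity)]
        have : R ^ k * R ≤ R ^ n := by
          rw [← pow_succ]; exact pow_le_pow_right₀ hR hn
        calc (n.factorial : ℝ) * (C * (2 ^ k * R ^ k))
            = n.factorial * (C * 2 ^ k) * R⁻¹ * (R ^ k * R) := by field_simp
          _ ≤ _ := by gcongr
    have hlim : Tendsto (fun R : ℝ => n.factorial * (C * 2 ^ k) * R⁻¹) atTop (𝓝 0) := by
      simpa using tendsto_inv_atTop_zero.const_mul ((n.factorial : ℝ) * (C * 2 ^ k))
    have := ge_of_tendsto hlim ((eventually_ge_atTop 1).mono hb)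
    exact norm_le_zero_iff.1 this
  refine ⟨∑ n ∈ Finset.range (k + 1),
    Polynomial.C ((n.factorial : ℂ)⁻¹ * iteratedDeriv n G 0) * Polynomial.X ^ n, fun z => ?_⟩
  have hs := Complex.hasSum_taylorSeries_of_entire hG 0 z
  have := hs.unique (hasSum_sum_of_ne_finset_zero (s := Finset.range (k + 1)) fun n hn => by
    rw [hder n (by simpa using hn)]; simp)
  rw [this, Polynomial.eval_finsetSum]
  refine Finset.sum_congr rfl fun n _ => ?_
  simp only [sub_zero, smul_eq_mul, Polynomial.eval_mul, Polynomial.eval_C, Polynomial.eval_pow,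
    Polynomial.eval_X]
  ring

/-! ### Polynomials and exponentials of polynomials along rays -/

/-- Off `0` the quotient is the reversed polynomial at `1/z`, whose constant term is the leading
coefficient of `q`. -/
theorem Polynomial.tendsto_eval_div_pow (q : ℂ[X]) :
    Tendsto (fun z => q.eval z / z ^ q.natDegree) (Bornology.cobounded ℂ)
      (𝓝 q.leadingCoeff) := by
  have h1 : Tendsto (fun z : ℂ => q.reverse.eval z⁻¹) (Bornology.cobounded ℂ)
      (𝓝 (q.reverse.eval 0)) :=
    (q.reverse.continuous.tendsto 0).comp tendsto_inv₀_cobounded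
  rw [← Polynomial.coeff_zero_eq_eval_zero, Polynomial.coeff_zero_reverse] at h1
  refine h1.congr' ?_
  filter_upwards [Bornology.eventually_ne_cobounded (0 : ℂ)] with z hz
  rw [eq_div_iff (pow_ne_zero _ hz)]
  let _ : Invertible z := invertibleOfNonzero hz
  have := Polynomial.eval₂_reverse_mul_pow (RingHom.id ℂ) z q
  simpa [Polynomial.eval₂_id] using this

/-- The principal filter on the unit disc encodes uniformity over the discs of radius `1` centred on
the ray, on which Cauchy estimates are applied later. -/
theorem tendsto_ray_add_closedBall {u : ℂ} (hu : ‖u‖ = 1) :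
    Tendsto (fun x : ℝ × ℂ => (x.1 : ℂ) * u + x.2) (atTop ×ˢ 𝓟 (closedBall 0 1))
      (Bornology.cobounded ℂ) := by
  rw [← tendsto_norm_atTop_iff_cobounded]
  have h : Tendsto (fun x : ℝ × ℂ => x.1 - 1) (atTop ×ˢ 𝓟 (closedBall 0 1)) atTop :=
    (tendsto_atTop_add_const_right _ (-1) tendsto_id).comp tendsto_fst
  refine tendsto_atTop_mono' _ ?_ h
  have h2 : ∀ᶠ x : ℝ × ℂ in atTop ×ˢ 𝓟 (closedBall 0 1), x.2 ∈ closedBall (0 : ℂ) 1 :=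
    tendsto_snd.eventually (mem_principal_self _)
  filter_upwards [h2] with x hx
  have h3 := norm_sub_norm_le ((x.1 : ℂ) * u) (-x.2)
  rw [sub_neg_eq_add, norm_neg, norm_mul, hu, mul_one, Complex.norm_real, Real.norm_eq_abs] at h3
  have := mem_closedBall_zero_iff.1 hx
  linarith [le_abs_self x.1]

/-- Uniformly on these discs `q(w) / r ^ d` tends to `q.leadingCoeff * u ^ d`; half the real part of
this limit serves as `c`, and `r ≤ r ^ d`. -/
theorem Polynomial.exists_mul_le_re_eval {q : ℂ[X]} (hd : 1 ≤ q.natDegree) {u : ℂ}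
    (hu : ‖u‖ = 1) (h : 0 < (q.leadingCoeff * u ^ q.natDegree).re) :
    ∃ c : ℝ, 0 < c ∧ ∀ᶠ r : ℝ in atTop, ∀ w ∈ closedBall ((r : ℂ) * u) 1,
      c * r ≤ (q.eval w).re := by
  set d := q.natDegree
  set l : Filter (ℝ × ℂ) := atTop ×ˢ 𝓟 (closedBall 0 1) with hl
  set W : ℝ × ℂ → ℂ := fun x => (x.1 : ℂ) * u + x.2
  have hx1 : Tendsto (fun x : ℝ × ℂ => x.1) l atTop := tendsto_fst
  have h2 : ∀ᶠ x : ℝ × ℂ in l, x.2 ∈ closedBall (0 : ℂ) 1 :=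
    tendsto_snd.eventually (mem_principal_self _)
  have hW : Tendsto (fun x => W x / x.1) l (𝓝 u) := by
    have h0 : Tendsto (fun x : ℝ × ℂ => x.2 / (x.1 : ℂ)) l (𝓝 0) := by
      rw [tendsto_zero_iff_norm_tendsto_zero]
      refine squeeze_zero' (Eventually.of_forall fun _ => norm_nonneg _) ?_
        (tendsto_inv_atTop_zero.comp hx1)
      filter_upwards [h2, hx1.eventually_gt_atTop 0] with x hx hx0
      rw [norm_div, Complex.norm_real, Real.norm_of_nonneg hx0.le, div_eq_mul_inv]
      exact mul_le_of_le_one_left (by positivity) (mem_closedBall_zero_iff.1 hx)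
    have h3 : Tendsto (fun x : ℝ × ℂ => u + x.2 / (x.1 : ℂ)) l (𝓝 u) := by
      simpa using h0.const_add u
    refine h3.congr' ?_
    filter_upwards [hx1.eventually_gt_atTop 0] with x hx0
    have : (x.1 : ℂ) ≠ 0 := by exact_mod_cast hx0.ne'
    simp only [W]
    field_simp
  have hWc := tendsto_ray_add_closedBall hu
  have hlim : Tendsto (fun x => (q.eval (W x) / W x ^ d) * (W x / x.1) ^ d) l
      (𝓝 (q.leadingCoeff * u ^ d)) := ((q.tendsto_eval_div_pow).comp hWc).mul (hW.pow d)
  have hre := (Complex.continuous_re.tendsto _).comp hlim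
  set c := (q.leadingCoeff * u ^ d).re / 2
  have hc : c < (q.leadingCoeff * u ^ d).re := by simp only [c]; linarith
  have hev : ∀ᶠ x in l, c * x.1 ≤ (q.eval (W x)).re := by
    filter_upwards [hre.eventually_const_lt hc, hx1.eventually_ge_atTop 1,
      hWc.eventually (Bornology.eventually_ne_cobounded 0)] with x hx hx1 hW0
    have hx0 : (x.1 : ℂ) ≠ 0 := by exact_mod_cast (by linarith : x.1 ≠ 0)
    have e : q.eval (W x) = ((x.1 ^ d : ℝ) : ℂ) * ((q.eval (W x) / W x ^ d) * (W x / x.1) ^ d) := by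
      have hW0 : W x ≠ 0 := hW0
      push_cast
      rw [div_pow]
      field_simp
    rw [e, Complex.re_ofReal_mul]
    have hc0 : 0 < c := by simp only [c]; linarith
    have : x.1 ≤ x.1 ^ d := le_self_pow₀ hx1 (by omega)
    calc c * x.1 ≤ x.1 ^ d * c := by nlinarith
      _ ≤ _ := mul_le_mul_of_nonneg_left hx.le (by positivity)
  refine ⟨c, by simp only [c]; linarith, ?_⟩
  rw [hl, eventually_prod_principal_iff] at hev
  filter_upwards [hev] with r hr w hw
  have := hr (w - r * u) (by rw [mem_closedBall_zero_iff, ← dist_eq_norm]; exact hw)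
  simpa [W] using this

theorem Polynomial.exists_le_norm_eval {p : ℂ[X]} (hp : p ≠ 0) :
    ∃ c : ℝ, 0 < c ∧ ∀ᶠ z in Bornology.cobounded ℂ, c * ‖z‖ ^ p.natDegree ≤ ‖p.eval z‖ := by
  have hl : 0 < ‖p.leadingCoeff‖ := by simpa using hp
  refine ⟨‖p.leadingCoeff‖ / 2, by positivity, ?_⟩
  filter_upwards [p.tendsto_eval_div_pow.norm.eventually_const_lt (half_lt_self hl),
    Bornology.eventually_ne_cobounded 0] with z hz hz0
  rw [norm_div, norm_pow, lt_div_iff₀ (by positivity)] at hz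
  exact hz.le

theorem tendsto_ray {u : ℂ} (hu : ‖u‖ = 1) :
    Tendsto (fun r : ℝ => (r : ℂ) * u) atTop (Bornology.cobounded ℂ) := by
  rw [← tendsto_norm_atTop_iff_cobounded]
  simpa [hu] using tendsto_abs_atTop_atTop (G := ℝ)

theorem eventually_mul_pow_le_exp {c : ℝ} (hc : 0 < c) (C : ℝ) (m : ℕ) :
    ∀ᶠ r : ℝ in atTop, C * (1 + r) ^ m ≤ Real.exp (c * r) := by
  have h1 : Tendsto (fun r : ℝ => Real.exp (c * r) / (c * r) ^ m) atTop atTop :=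
    (Real.tendsto_exp_div_pow_atTop m).comp (tendsto_id.const_mul_atTop hc)
  filter_upwards [h1.eventually_ge_atTop (|C| * (2 / c) ^ m), eventually_ge_atTop 1] with r hr hr1
  rw [le_div_iff₀ (by positivity), mul_assoc, ← mul_pow] at hr
  refine le_trans ?_ hr
  have : (2 / c * (c * r)) = 2 * r := by field_simp
  rw [this]
  gcongr
  · exact le_abs_self C
  · linarith

/-- In the directions where `Re q → ∞`, the function `N e^q` dominates all powers. -/
theorem Polynomial.eventually_mul_pow_le_norm_mul_exp {q N : ℂ[X]} (hd : 1 ≤ q.natDegree)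
    (hN : N ≠ 0) {u : ℂ} (hu : ‖u‖ = 1) (h : 0 < (q.leadingCoeff * u ^ q.natDegree).re)
    (C : ℝ) (m : ℕ) : ∀ᶠ r : ℝ in atTop, ∀ w ∈ closedBall ((r : ℂ) * u) 1,
      C * (1 + r) ^ m ≤ ‖N.eval w * Complex.exp (q.eval w)‖ := by
  obtain ⟨c, hc, hq⟩ := Polynomial.exists_mul_le_re_eval hd hu h
  obtain ⟨b, hb, hN⟩ := Polynomial.exists_le_norm_eval hN
  have hN2 := (tendsto_ray_add_closedBall hu).eventually
    (hN.and (tendsto_norm_cobounded_atTop.eventually_ge_atTop 1))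
  rw [eventually_prod_principal_iff] at hN2
  filter_upwards [hq, hN2, eventually_mul_pow_le_exp hc (C / b) m] with r h1 h2 h3 w hw
  obtain ⟨h4, h5⟩ := h2 (w - r * u) (by rw [mem_closedBall_zero_iff, ← dist_eq_norm]; exact hw)
  rw [add_sub_cancel] at h4 h5
  rw [norm_mul, Complex.norm_exp]
  calc C * (1 + r) ^ m = b * (C / b * (1 + r) ^ m) := by field_simp
    _ ≤ ‖N.eval w‖ * Real.exp (q.eval w).re := by
      refine mul_le_mul_of_nonneg (?_ : b ≤ _) (h3.trans (Real.exp_le_exp.2 (h1 w hw))) hb.le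
        (Real.exp_pos _).le
      exact (le_mul_of_one_le_right hb.le (one_le_pow₀ h5)).trans h4

/-- In the directions where `Re q → -∞`, the function `N e^q` is bounded. -/
theorem Polynomial.eventually_mul_pow_norm_mul_exp_le {q N : ℂ[X]} (hd : 1 ≤ q.natDegree)
    {u : ℂ} (hu : ‖u‖ = 1) (h : (q.leadingCoeff * u ^ q.natDegree).re < 0) :
    ∀ᶠ r : ℝ in atTop, r * ‖N.eval (r * u) * Complex.exp (q.eval (r * u))‖ ≤ 1 := by
  obtain ⟨c, hc, hq⟩ := Polynomial.exists_mul_le_re_eval (q := -q) (by simpa using hd) hu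
    (by simpa using h)
  obtain ⟨C, hC, k, hk⟩ := N.exists_norm_eval_le
  filter_upwards [hq, eventually_mul_pow_le_exp hc C (k + 1), eventually_ge_atTop 0] with r h1 h2 h3
  have h4 := h1 (r * u) (mem_closedBall_self zero_le_one)
  rw [Polynomial.eval_neg, Complex.neg_re] at h4
  have h5 := hk (r * u)
  rw [norm_mul (r : ℂ), hu, mul_one, Complex.norm_real, Real.norm_of_nonneg h3] at h5
  rw [norm_mul, Complex.norm_exp]
  calc r * (‖N.eval (r * u)‖ * Real.exp (q.eval (r * u)).re)
      ≤ (1 + r) * ((C * (1 + r) ^ k) * Real.exp (-(c * r))) := by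
        gcongr <;> linarith
    _ = (C * (1 + r) ^ (k + 1)) * Real.exp (-(c * r)) := by ring
    _ ≤ Real.exp (c * r) * Real.exp (-(c * r)) := by gcongr
    _ = 1 := by rw [← Real.exp_add]; simp

/-! ### The differential equation along a single ray -/

/-- Shrinking the disc by `1/n` costs a factor `n` in Cauchy's estimate for `G'`, but `hder` returns
a factor `4n`. As `e ≤ 4`, each step lowers the bound from `e^(n-k) + 1` to `e^(n-k-1) + 1`, and `n`
steps end at the centre with `2`. -/
theorem norm_le_two_of_mul_norm_le_norm_deriv {G : ℂ → ℂ} {z : ℂ} {n : ℕ} (hn : 1 ≤ n)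
    (hG : Differentiable ℂ G) (hb : ∀ w ∈ closedBall z 1, ‖G w‖ ≤ Real.exp n)
    (hder : ∀ w ∈ closedBall z 1, 4 * n * ‖G w‖ ≤ ‖deriv G w‖ + 1) : ‖G z‖ ≤ 2 := by
  have hn0 : (1 : ℝ) ≤ n := by exact_mod_cast hn
  have key : ∀ k ≤ n, ∀ w ∈ closedBall z (1 - k / n), ‖G w‖ ≤ Real.exp (n - k) + 1 := by
    intro k
    induction k with
    | zero =>
      intro _ w hw
      have := hb w (by simpa using hw)
      simp only [CharP.cast_eq_zero, sub_zero]
      linarith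
    | succ k ih =>
      intro hk w hw
      have hkn : ((k + 1 : ℕ) : ℝ) / n = k / n + 1 / n := by push_cast; ring
      have hw1 : w ∈ closedBall z 1 :=
        closedBall_subset_closedBall (by simp only [sub_le_self_iff]; positivity) hw
      have hd := Complex.norm_deriv_le_of_forall_mem_sphere_norm_le (f := G) (c := w)
        (R := 1 / n) (C := Real.exp (n - k) + 1) (by positivity) hG.diffContOnCl fun v hv => by
          refine ih (by omega) v ?_
          rw [mem_closedBall] at hw ⊢
          rw [mem_sphere] at hv
          have := dist_triangle v w z
          rw [hkn] at hw
          linarith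
      rw [div_div_eq_mul_div, div_one] at hd
      have h4 := hder w hw1
      have he : Real.exp (n - k) ≤ 4 * Real.exp (n - (k + 1 : ℕ)) := by
        have : (n : ℝ) - k = 1 + (n - (k + 1 : ℕ)) := by push_cast; ring
        rw [this, Real.exp_add]
        gcongr
        linarith [Real.exp_one_lt_d9]
      have h5 : n * (4 * ‖G w‖) ≤ n * (Real.exp (n - k) + 2) := by nlinarith
      have h6 := le_of_mul_le_mul_left h5 (by linarith)
      linarith [Real.exp_pos ((n : ℝ) - k)]
  have := key n le_rfl z (by rw [div_self (by linarith)]; simp)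
  simpa [one_add_one_eq_two] using this

/-- On a ray along which `N e^q` grows exponentially, an entire solution `G` of finite order
of `D G' = (E + N e^q) G + S` is bounded. -/
theorem eventually_norm_le_two_of_growth {G : ℂ → ℂ} (hG : HasExpGrowth G)
    {D E N S q : ℂ[X]} (hN : N ≠ 0) (hd : 1 ≤ q.natDegree)
    (hode : ∀ z, D.eval z * deriv G z
      = (E.eval z + N.eval z * Complex.exp (q.eval z)) * G z + S.eval z)
    {u : ℂ} (hu : ‖u‖ = 1) (h : 0 < (q.leadingCoeff * u ^ q.natDegree).re) :
    ∀ᶠ r : ℝ in atTop, ‖G (r * u)‖ ≤ 2 := by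
  obtain ⟨dG, A, hA, m, hm⟩ := hG
  obtain ⟨CD, hCD, kD, hkD⟩ := D.exists_norm_eval_le
  obtain ⟨CE, hCE, kE, hkE⟩ := E.exists_norm_eval_le
  obtain ⟨CS, hCS, kS, hkS⟩ := S.exists_norm_eval_le
  set K := m + kD + kE + kS with hK
  filter_upwards [Polynomial.eventually_mul_pow_le_norm_mul_exp hd hN hu h
    ((4 * (A + 2) * (CD + CS + 1) + CE) * 2 ^ (K + K)) (K + K), eventually_ge_atTop 1] with r hr hr1
  -- On the unit disc `1 + ‖w‖ ≤ 2 + r`, so `e^n` bounds `G` there, while `n` itself grows only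
  -- polynomially in `r`.
  set n : ℕ := ⌈A * (2 + r) ^ m⌉₊ + 1
  have hn1 : A * (2 + r) ^ m ≤ n := by
    have := Nat.le_ceil (A * (2 + r) ^ m)
    simp only [n]; push_cast; linarith
  have hn2 : (n : ℝ) ≤ A * (2 + r) ^ m + 2 := by
    have := (Nat.ceil_lt_add_one (show 0 ≤ A * (2 + r) ^ m by positivity)).le
    simp only [n]; push_cast; linarith
  have hwr : ∀ w ∈ closedBall ((r : ℂ) * u) 1, 1 + ‖w‖ ≤ 2 + r := by
    intro w hw
    have h1 := norm_le_norm_add_norm_sub' w ((r : ℂ) * u)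
    rw [← dist_eq_norm, norm_mul, hu, mul_one, Complex.norm_real,
      Real.norm_of_nonneg (by linarith)] at h1
    linarith [mem_closedBall.1 hw]
  have hpow : ∀ w ∈ closedBall ((r : ℂ) * u) 1, ∀ k ≤ K, (1 + ‖w‖) ^ k ≤ (2 + r) ^ K := by
    intro w hw k hk
    exact (pow_le_pow_left₀ (by positivity) (hwr w hw) k).trans
      (pow_le_pow_right₀ (by linarith) hk)
  have h2r : (1 : ℝ) ≤ (2 + r) ^ K := one_le_pow₀ (by linarith)
  refine norm_le_two_of_mul_norm_le_norm_deriv (n := n) (by simp [n]) dG (fun w hw => ?_)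
    (fun w hw => ?_)
  · refine (hm w).trans (Real.exp_le_exp.2 (le_trans ?_ hn1))
    have := hwr w hw
    gcongr
  · have hDw : ‖D.eval w‖ ≤ CD * (2 + r) ^ K :=
      (hkD w).trans (by gcongr; exact hpow w hw _ (by omega))
    have hEw : ‖E.eval w‖ ≤ CE * (2 + r) ^ K :=
      (hkE w).trans (by gcongr; exact hpow w hw _ (by omega))
    have hSw : ‖S.eval w‖ ≤ CS * (2 + r) ^ K :=
      (hkS w).trans (by gcongr; exact hpow w hw _ (by omega))
    have hn3 : (n : ℝ) ≤ (A + 2) * (2 + r) ^ K := by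
      have : (2 + r) ^ m ≤ (2 + r) ^ K := pow_le_pow_right₀ (by linarith) (by omega)
      nlinarith
    have hbig := hr w hw
    -- Dividing the equation by `B`, which dominates both `D` and `S`, leaves `4 n ‖G‖ ≤ ‖G'‖ + 1`.
    set B := ‖D.eval w‖ + ‖S.eval w‖ + 1 with hB
    have hBle : B ≤ (CD + CS + 1) * (2 + r) ^ K := by linarith
    have hmain : 4 * n * B + ‖E.eval w‖ ≤ ‖N.eval w * Complex.exp (q.eval w)‖ := by
      refine le_trans ?_ hbig
      have h3 : ((2 : ℝ) + r) ^ (K + K) ≤ 2 ^ (K + K) * (1 + r) ^ (K + K) := by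
        rw [← mul_pow]; gcongr; linarith
      have h4 : (n : ℝ) * B ≤ ((A + 2) * (2 + r) ^ K) * ((CD + CS + 1) * (2 + r) ^ K) := by
        gcongr
      have h5 : (2 + r) ^ K ≤ (2 + r) ^ (K + K) := pow_le_pow_right₀ (by linarith) (by omega)
      calc 4 * n * B + ‖E.eval w‖
          ≤ 4 * (((A + 2) * (2 + r) ^ K) * ((CD + CS + 1) * (2 + r) ^ K))
            + CE * (2 + r) ^ (K + K) := by nlinarith
        _ = (4 * (A + 2) * (CD + CS + 1) + CE) * (2 + r) ^ (K + K) := by rw [pow_add]; ring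
        _ ≤ (4 * (A + 2) * (CD + CS + 1) + CE) * (2 ^ (K + K) * (1 + r) ^ (K + K)) := by gcongr
        _ = _ := by ring
    have hlow : (4 * n * B) * ‖G w‖ ≤ ‖D.eval w‖ * ‖deriv G w‖ + ‖S.eval w‖ := by
      have h6 : ‖(E.eval w + N.eval w * Complex.exp (q.eval w)) * G w‖
          ≤ ‖D.eval w‖ * ‖deriv G w‖ + ‖S.eval w‖ := by
        have : (E.eval w + N.eval w * Complex.exp (q.eval w)) * G w
            = D.eval w * deriv G w - S.eval w := by rw [hode]; ring
        rw [this, ← norm_mul]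
        exact norm_sub_le _ _
      refine le_trans ?_ h6
      rw [norm_mul]
      gcongr
      have := norm_sub_le (E.eval w + N.eval w * Complex.exp (q.eval w)) (E.eval w)
      rw [add_sub_cancel_left] at this
      linarith
    have hB1 : 1 ≤ B := by simp only [hB]; linarith [norm_nonneg (D.eval w), norm_nonneg (S.eval w)]
    have h7 : B * (4 * n * ‖G w‖) ≤ B * (‖deriv G w‖ + 1) := by
      have : ‖D.eval w‖ * ‖deriv G w‖ + ‖S.eval w‖ ≤ B * (‖deriv G w‖ + 1) := by
        simp only [hB]
        nlinarith [norm_nonneg (D.eval w), norm_nonneg (S.eval w), norm_nonneg (deriv G w),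
          mul_nonneg (norm_nonneg (S.eval w)) (norm_nonneg (deriv G w))]
      linarith
    exact le_of_mul_le_mul_left h7 (by linarith)

/-- On a ray along which `N e^q` decays, a solution `G` of `D G' = (E + N e^q) G + S` with
`deg E < deg D` grows at most polynomially. -/
theorem exists_eventually_norm_le_of_decay {G : ℂ → ℂ} (dG : Differentiable ℂ G)
    {D E N S q : ℂ[X]} (hD : D ≠ 0) (hED : E.degree < D.degree) (hd : 1 ≤ q.natDegree)
    (hode : ∀ z, D.eval z * deriv G z
      = (E.eval z + N.eval z * Complex.exp (q.eval z)) * G z + S.eval z)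
    {u : ℂ} (hu : ‖u‖ = 1) (h : (q.leadingCoeff * u ^ q.natDegree).re < 0) :
    ∃ C : ℝ, ∃ k : ℕ, ∀ᶠ r : ℝ in atTop, ‖G (r * u)‖ ≤ C * r ^ k := by
  obtain ⟨b, hb, hDb⟩ := Polynomial.exists_le_norm_eval hD
  obtain ⟨CS, hCS, kS, hkS⟩ := S.exists_norm_eval_le
  -- The degree gap is used here: `E / D` is `O(1/r)`.
  have hEb : ∃ CE : ℝ, 0 ≤ CE ∧ ∀ᶠ z in Bornology.cobounded ℂ,
      ‖z‖ * ‖E.eval z‖ ≤ CE * ‖D.eval z‖ := by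
    rcases eq_or_ne E 0 with rfl | hE0
    · exact ⟨0, le_rfl, by simp⟩
    have hlt := Polynomial.natDegree_lt_natDegree hE0 hED
    refine ⟨(‖E.leadingCoeff‖ + 1) / b, by positivity, ?_⟩
    filter_upwards [hDb, E.tendsto_eval_div_pow.norm.eventually_le_const (lt_add_one _),
      tendsto_norm_cobounded_atTop.eventually_ge_atTop 1] with z h1 h2 h3
    rw [norm_div, norm_pow, div_le_iff₀ (by positivity)] at h2
    calc ‖z‖ * ‖E.eval z‖ ≤ ‖z‖ * ((‖E.leadingCoeff‖ + 1) * ‖z‖ ^ E.natDegree) := by gcongr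
      _ = (‖E.leadingCoeff‖ + 1) / b * (b * ‖z‖ ^ (E.natDegree + 1)) := by field_simp; ring
      _ ≤ (‖E.leadingCoeff‖ + 1) / b * (b * ‖z‖ ^ D.natDegree) := by gcongr; exact hlt
      _ ≤ _ := by gcongr
  obtain ⟨CE, hCE, hE⟩ := hEb
  have hray := tendsto_ray hu
  obtain ⟨r₀, hr₀⟩ := eventually_atTop.1 ((hray.eventually hDb).and ((hray.eventually hE).and
    ((Polynomial.eventually_mul_pow_norm_mul_exp_le (N := N) hd hu h).and
      (eventually_ge_atTop 1))))
  have hr₀1 : 1 ≤ r₀ := (hr₀ r₀ le_rfl).2.2.2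
  -- With `r = e^s` the `O(1/r)` coefficient becomes bounded, so Grönwall's factor `e^(K s)` is the
  -- power `r ^ K`.
  set f : ℝ → ℂ := fun s => G ((Real.exp s : ℝ) * u)
  have hf : ∀ s, HasDerivAt f (deriv G ((Real.exp s : ℝ) * u) * ((Real.exp s : ℝ) * u)) s := by
    intro s
    have h1 : HasDerivAt (fun s : ℝ => ((Real.exp s : ℝ) : ℂ) * u) ((Real.exp s : ℝ) * u) s :=
      ((Real.hasDerivAt_exp s).ofReal_comp).mul_const u
    exact (dG _).hasDerivAt.comp s h1
  set K : ℕ := ⌈CE + 1 / b⌉₊ + 1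
  have hK : CE + 1 / b ≤ K := by
    have := Nat.le_ceil (CE + 1 / b)
    simp only [K]; push_cast; linarith
  have hK1 : (1 : ℝ) ≤ K := by simp [K]
  -- The inhomogeneous term is replaced by a bound at the right end `r₁`, as Grönwall's inequality
  -- takes a constant there.
  have hbound : ∀ r₁ : ℝ, ∀ s ∈ Ico (Real.log r₀) (Real.log r₁), 0 < r₁ →
      ‖deriv G ((Real.exp s : ℝ) * u) * ((Real.exp s : ℝ) * u)‖
        ≤ K * ‖f s‖ + CS / b * (1 + r₁) ^ (kS + 1) := by
    intro r₁ s hs hr₁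
    set r := Real.exp s
    have hr : r₀ ≤ r := (Real.log_le_iff_le_exp (by linarith)).1 hs.1
    have hr1 : r ≤ r₁ := ((Real.lt_log_iff_exp_lt hr₁).1 hs.2).le
    obtain ⟨g1, g2, g3, g4⟩ := hr₀ r hr
    have hnorm : ‖(r : ℂ) * u‖ = r := by
      rw [norm_mul, hu, mul_one, Complex.norm_real, Real.norm_of_nonneg (by linarith)]
    rw [hnorm] at g1 g2
    have hDlow : b ≤ ‖D.eval (r * u)‖ :=
      (le_mul_of_one_le_right hb.le (one_le_pow₀ g4)).trans g1
    have hS := hkS (r * u)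
    rw [hnorm] at hS
    have h1 : ‖D.eval (r * u)‖ * ‖deriv G (r * u)‖
        ≤ (‖E.eval (r * u)‖ + ‖N.eval (r * u) * Complex.exp (q.eval (r * u))‖) * ‖f s‖
          + ‖S.eval (r * u)‖ := by
      rw [← norm_mul, hode]
      refine (norm_add_le _ _).trans ?_
      rw [norm_mul]
      gcongr
      exact norm_add_le _ _
    rw [norm_mul, hnorm]
    refine le_of_mul_le_mul_left ?_ (hb.trans_le hDlow)
    have hrS : r * ‖S.eval (r * u)‖ ≤ CS * (1 + r₁) ^ (kS + 1) := by
      calc r * ‖S.eval (r * u)‖ ≤ (1 + r₁) * (CS * (1 + r₁) ^ kS) := by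
            gcongr
            · linarith
            · exact hS.trans (by gcongr)
        _ = _ := by ring
    have hb1 : 1 ≤ ‖D.eval (r * u)‖ * (1 / b) := by
      rw [mul_one_div, one_le_div hb]; exact hDlow
    have hCSr : 0 ≤ CS * (1 + r₁) ^ (kS + 1) := by positivity
    calc ‖D.eval (r * u)‖ * (‖deriv G (r * u)‖ * r)
        = r * (‖D.eval (r * u)‖ * ‖deriv G (r * u)‖) := by ring
      _ ≤ r * ((‖E.eval (r * u)‖ + ‖N.eval (r * u) * Complex.exp (q.eval (r * u))‖) * ‖f s‖
          + ‖S.eval (r * u)‖) := by gcongr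
      _ = (r * ‖E.eval (r * u)‖ + r * ‖N.eval (r * u) * Complex.exp (q.eval (r * u))‖) * ‖f s‖
          + r * ‖S.eval (r * u)‖ := by ring
      _ ≤ (CE * ‖D.eval (r * u)‖ + ‖D.eval (r * u)‖ * (1 / b)) * ‖f s‖
          + (‖D.eval (r * u)‖ * (1 / b)) * (CS * (1 + r₁) ^ (kS + 1)) :=
        add_le_add (mul_le_mul_of_nonneg_right (add_le_add g2 (g3.trans hb1)) (norm_nonneg _))
          (hrS.trans (le_mul_of_one_le_left hCSr hb1))
      _ = ‖D.eval (r * u)‖ * ((CE + 1 / b) * ‖f s‖ + CS / b * (1 + r₁) ^ (kS + 1)) := by ring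
      _ ≤ _ := by gcongr
  refine ⟨‖f (Real.log r₀)‖ + CS / b * 2 ^ (kS + 1), K + (kS + 1), ?_⟩
  filter_upwards [eventually_ge_atTop r₀] with r hr
  have hr0 : 0 < r := by linarith
  have hlog : Real.log r₀ ≤ Real.log r := Real.log_le_log (by linarith) hr
  have hgr := norm_le_gronwallBound_of_norm_deriv_right_le (f := f)
    (fun s _ => (hf s).continuousAt.continuousWithinAt) (fun s _ => (hf s).hasDerivWithinAt)
    le_rfl (fun s hs => hbound r s hs hr0) (Real.log r) ⟨hlog, le_rfl⟩
  rw [gronwallBound_of_K_ne_0 (by linarith)] at hgr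
  have hexp : Real.exp (K * (Real.log r - Real.log r₀)) ≤ r ^ K := by
    have : Real.exp (K * Real.log r) = r ^ K := by
      rw [Real.exp_nat_mul, Real.exp_log hr0]
    rw [← this, Real.exp_le_exp]
    have := Real.log_nonneg hr₀1
    gcongr
    linarith
  have hfr : f (Real.log r) = G (r * u) := by simp only [f, Real.exp_log hr0]
  rw [hfr] at hgr
  refine hgr.trans ?_
  have h2r : CS / b * (1 + r) ^ (kS + 1) ≤ CS / b * 2 ^ (kS + 1) * r ^ (kS + 1) := by
    rw [mul_assoc, ← mul_pow]
    gcongr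
    linarith
  have hrp : 1 ≤ r ^ (kS + 1) := one_le_pow₀ (by linarith)
  have hKdiv : CS / b * (1 + r) ^ (kS + 1) / K ≤ CS / b * (1 + r) ^ (kS + 1) :=
    div_le_self (by positivity) hK1
  have hbr : 0 ≤ CS / b * (1 + r) ^ (kS + 1) / K := by positivity
  calc ‖f (Real.log r₀)‖ * Real.exp (K * (Real.log r - Real.log r₀))
        + CS / b * (1 + r) ^ (kS + 1) / K * (Real.exp (K * (Real.log r - Real.log r₀)) - 1)
      ≤ ‖f (Real.log r₀)‖ * r ^ K
        + CS / b * (1 + r) ^ (kS + 1) / K * r ^ K := by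
        gcongr
        linarith
    _ ≤ ‖f (Real.log r₀)‖ * (r ^ K * r ^ (kS + 1))
        + CS / b * 2 ^ (kS + 1) * r ^ (kS + 1) * r ^ K := by
        gcongr
        · exact le_mul_of_one_le_right (by positivity) hrp
        · exact hKdiv.trans h2r
    _ = _ := by rw [pow_add]; ring

/-! ### From polynomial growth on rays to polynomials -/

/-- Phragmén–Lindelöf in a thin sector: polynomial bounds on the two bounding rays of an entire
function of finite order extend to the sector. -/
theorem norm_le_of_mem_sector {G : ℂ → ℂ} (dG : Differentiable ℂ G) {A : ℝ} (hA : 0 ≤ A) {m : ℕ}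
    (hm : ∀ z, ‖G z‖ ≤ Real.exp (A * (1 + ‖z‖) ^ m)) {α β : ℝ} (hαβ : α < β)
    (hsmall : (β - α) * (m + 1) ≤ Real.pi) {C : ℝ} (hC : 0 ≤ C) {k : ℕ}
    (hα : ∀ ζ : ℂ, ζ.im = α → ‖G (Complex.exp ζ)‖ ≤ C * (1 + Real.exp ζ.re) ^ k)
    (hβ : ∀ ζ : ℂ, ζ.im = β → ‖G (Complex.exp ζ)‖ ≤ C * (1 + Real.exp ζ.re) ^ k)
    {ζ : ℂ} (h₁ : α ≤ ζ.im) (h₂ : ζ.im ≤ β) :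
    ‖G (Complex.exp ζ)‖ ≤ C * 2 ^ k * (1 + Real.exp ζ.re) ^ k := by
  have hlen : β - α ≤ Real.pi := by
    have : (0 : ℝ) ≤ m := by positivity
    nlinarith
  -- `v` marks the bisecting direction. The opening is at most `π`, so `e^(ζ - v)` has nonnegative
  -- real part and `|den ζ|` is comparable to `1 + e^(Re ζ)`; dividing by `den ^ k` makes the
  -- boundary bounds constant.
  set v : ℂ := ((α + β) / 2 : ℝ) * Complex.I with hv
  set den : ℂ → ℂ := fun ζ => 1 + Complex.exp (ζ - v)
  have hden : ∀ ζ : ℂ, α ≤ ζ.im → ζ.im ≤ β →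
      1 ≤ ‖den ζ‖ ∧ 1 + Real.exp ζ.re ≤ 2 * ‖den ζ‖ := by
    intro ζ h₁ h₂
    have hre : (Complex.exp (ζ - v)).re = Real.exp ζ.re * Real.cos (ζ.im - (α + β) / 2) := by
      rw [Complex.exp_re]; simp [hv]
    have hnorm : ‖Complex.exp (ζ - v)‖ = Real.exp ζ.re := by
      rw [Complex.norm_exp]; simp [hv]
    have hcos : 0 ≤ Real.cos (ζ.im - (α + β) / 2) :=
      Real.cos_nonneg_of_mem_Icc ⟨by linarith, by linarith⟩
    have hre0 : 0 ≤ (Complex.exp (ζ - v)).re := by rw [hre]; positivity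
    have h3 : 1 ≤ ‖den ζ‖ := by
      have := Complex.re_le_norm (den ζ)
      simp only [den, Complex.add_re, Complex.one_re] at this ⊢
      linarith
    have h4 : Real.exp ζ.re ≤ ‖den ζ‖ := by
      rw [← hnorm]
      refine (sq_le_sq₀ (norm_nonneg _) (norm_nonneg _)).1 ?_
      rw [Complex.sq_norm, Complex.sq_norm, Complex.normSq_apply, Complex.normSq_apply]
      simp only [den, Complex.add_re, Complex.one_re, Complex.add_im, Complex.one_im, zero_add]
      nlinarith
    exact ⟨h3, by linarith⟩
  set f : ℂ → ℂ := fun ζ => G (Complex.exp ζ) / den ζ ^ k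
  have hdenne : ∀ ζ : ℂ, α ≤ ζ.im → ζ.im ≤ β → den ζ ≠ 0 := fun ζ h₁ h₂ h0 => by
    have := (hden ζ h₁ h₂).1
    rw [h0, norm_zero] at this
    linarith
  have hfd : DiffContOnCl ℂ f (Complex.im ⁻¹' Ioo α β) := by
    refine DifferentiableOn.diffContOnCl fun ζ hζ => ?_
    have hcl : closure (Complex.im ⁻¹' Ioo α β) ⊆ Complex.im ⁻¹' Icc α β :=
      closure_minimal (preimage_mono Ioo_subset_Icc_self)
        (isClosed_Icc.preimage Complex.continuous_im)
    have hζ' := hcl hζ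
    have h1 : DifferentiableAt ℂ (fun ζ => G (Complex.exp ζ)) ζ := by fun_prop
    have h2 : DifferentiableAt ℂ (fun ζ => den ζ ^ k) ζ := by
      simp only [den]; fun_prop
    exact (h1.div h2 (pow_ne_zero _ (hdenne ζ hζ'.1 hζ'.2))).differentiableWithinAt
  have hbd : ∀ ζ : ℂ, α ≤ ζ.im → ζ.im ≤ β →
      ‖G (Complex.exp ζ)‖ ≤ C * (1 + Real.exp ζ.re) ^ k → ‖f ζ‖ ≤ C * 2 ^ k := by
    intro ζ h₁ h₂ h
    obtain ⟨h3, h4⟩ := hden ζ h₁ h₂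
    simp only [f]
    rw [norm_div, norm_pow, div_le_iff₀ (by positivity), mul_assoc, ← mul_pow]
    exact h.trans (by gcongr)
  -- In the variable `ζ = log z` the sector is a strip. Finite order gives the exponent `c = m`, and
  -- `hsmall`, stated with `m + 1`, makes `m < π / (β - α)` strict.
  have hgrowth : ∃ c < Real.pi / (β - α), ∃ B : ℝ,
      f =O[comap (_root_.abs ∘ Complex.re) atTop ⊓ 𝓟 (Complex.im ⁻¹' Ioo α β)]
        fun ζ => Real.exp (B * Real.exp (c * |ζ.re|)) := by
    refine ⟨m, ?_, A * 2 ^ m, ?_⟩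
    · rw [lt_div_iff₀ (by linarith)]
      nlinarith
    · refine Asymptotics.IsBigO.of_bound 1 ?_
      refine eventually_inf_principal.2 (Eventually.of_forall fun ζ hζ => ?_)
      have hζ1 : α ≤ ζ.im := hζ.1.le
      have hζ2 : ζ.im ≤ β := hζ.2.le
      obtain ⟨h3, h4⟩ := hden ζ hζ1 hζ2
      simp only [f]
      rw [norm_div, norm_pow, one_mul, Real.norm_of_nonneg (Real.exp_pos _).le]
      refine (div_le_self (norm_nonneg _) (one_le_pow₀ h3)).trans ((hm _).trans ?_)
      rw [Real.exp_le_exp, mul_assoc, Complex.norm_exp, Real.exp_nat_mul, ← mul_pow]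
      gcongr
      have h5 : Real.exp ζ.re ≤ Real.exp |ζ.re| := Real.exp_le_exp.2 (le_abs_self _)
      have h6 : 1 ≤ Real.exp |ζ.re| := Real.one_le_exp (abs_nonneg _)
      linarith
  have hfin := PhragmenLindelof.horizontal_strip (C := C * 2 ^ k) hfd hgrowth
    (fun z hz => hbd z hz.ge (by linarith) (hα z hz))
    (fun z hz => hbd z (by linarith) hz.le (hβ z hz)) h₁ h₂
  simp only [f] at hfin
  obtain ⟨h3, h4⟩ := hden ζ h₁ h₂
  rw [norm_div, norm_pow, div_le_iff₀ (by positivity)] at hfin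
  refine hfin.trans ?_
  gcongr
  refine (norm_add_le _ _).trans ?_
  rw [Complex.norm_exp]
  simp [hv]

/-- Polynomial growth of `G` in a set of directions. -/
def HasPolyGrowthOnAngles (G : ℂ → ℂ) (s : Set ℝ) : Prop :=
  ∃ C : ℝ, 0 ≤ C ∧ ∃ k : ℕ, ∀ ζ : ℂ, ζ.im ∈ s → ‖G (Complex.exp ζ)‖ ≤ C * (1 + Real.exp ζ.re) ^ k

theorem HasPolyGrowthOnAngles.union {G : ℂ → ℂ} {s t : Set ℝ} (hs : HasPolyGrowthOnAngles G s)
    (ht : HasPolyGrowthOnAngles G t) : HasPolyGrowthOnAngles G (s ∪ t) := by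
  obtain ⟨C, hC, k, h⟩ := hs
  obtain ⟨C', hC', k', h'⟩ := ht
  refine ⟨C + C', by positivity, k + k', fun ζ hζ => ?_⟩
  have h1 : (1 : ℝ) ≤ 1 + Real.exp ζ.re := by linarith [Real.exp_pos ζ.re]
  rcases hζ with hζ | hζ
  · refine (h ζ hζ).trans ?_
    gcongr
    · linarith
    · omega
  · refine (h' ζ hζ).trans ?_
    gcongr
    · linarith
    · omega

/-- Small radii are covered by compactness of a disc. -/
theorem HasPolyGrowthOnAngles.singleton {G : ℂ → ℂ} (dG : Continuous G) {t : ℝ} {C : ℝ} {k : ℕ}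
    (h : ∀ᶠ r : ℝ in atTop, ‖G (r * Complex.exp (t * Complex.I))‖ ≤ C * r ^ k) :
    HasPolyGrowthOnAngles G {t} := by
  obtain ⟨r₀, hr₀⟩ := eventually_atTop.1 h
  obtain ⟨B, hB⟩ := (isCompact_closedBall (0 : ℂ) |r₀|).exists_bound_of_continuousOn
    dG.continuousOn
  have hB0 : 0 ≤ B := (norm_nonneg _).trans (hB 0 (by simp))
  refine ⟨B + |C|, by positivity, k, fun ζ hζ => ?_⟩
  have hexp : Complex.exp ζ = (Real.exp ζ.re : ℝ) * Complex.exp (t * Complex.I) := by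
    conv_lhs => rw [← Complex.re_add_im ζ, Complex.exp_add]
    rw [mem_singleton_iff.1 hζ, Complex.ofReal_exp]
  set r := Real.exp ζ.re
  have hr : 0 < r := Real.exp_pos _
  have h1 : (1 : ℝ) ≤ (1 + r) ^ k := one_le_pow₀ (by linarith)
  rcases le_total r₀ r with hle | hle
  · rw [hexp]
    refine (hr₀ r hle).trans ?_
    gcongr
    · linarith [le_abs_self C]
    · linarith
  · refine (hB _ ?_).trans ?_
    · rw [mem_closedBall_zero_iff, Complex.norm_exp]
      exact hle.trans (le_abs_self _)
    · nlinarith [abs_nonneg C]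

/-- If `w` and `w e^(i d ε)` are both purely imaginary with `w ≠ 0`, then `sin (d ε) = 0`, which `0
< d ε < π` excludes. This gives density of the directions in which `Re q` tends to `±∞`. -/
theorem exists_mem_Ioo_re_mul_exp_ne_zero {a : ℂ} (ha : a ≠ 0) {d : ℕ} (hd : 1 ≤ d) {x y : ℝ}
    (hxy : x < y) : ∃ t ∈ Ioo x y, (a * Complex.exp (t * Complex.I) ^ d).re ≠ 0 := by
  by_contra! hcon
  have hd0 : (0 : ℝ) < d := by exact_mod_cast hd
  set s := (x + y) / 2
  obtain ⟨ε, hε0, hε1, hε2⟩ : ∃ ε : ℝ, 0 < ε ∧ ε < (y - x) / 2 ∧ d * ε < Real.pi := by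
    refine ⟨min ((y - x) / 4) (Real.pi / (2 * d)), ?_, ?_, ?_⟩
    · have := Real.pi_pos; apply lt_min <;> [linarith; positivity]
    · exact (min_le_left _ _).trans_lt (by linarith)
    · calc d * min ((y - x) / 4) (Real.pi / (2 * d)) ≤ d * (Real.pi / (2 * d)) := by
            gcongr; exact min_le_right _ _
        _ = Real.pi / 2 := by field_simp
        _ < Real.pi := by linarith [Real.pi_pos]
  have h1 := hcon s ⟨by simp only [s]; linarith, by simp only [s]; linarith⟩
  have h2 := hcon (s + ε) ⟨by simp only [s]; linarith, by simp only [s]; linarith⟩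
  set w := a * Complex.exp (s * Complex.I) ^ d
  have hw : w ≠ 0 := mul_ne_zero ha (pow_ne_zero _ (Complex.exp_ne_zero _))
  have e : a * Complex.exp ((s + ε : ℝ) * Complex.I) ^ d
      = w * Complex.exp ((d * ε : ℝ) * Complex.I) := by
    simp only [w]
    rw [mul_assoc, ← Complex.exp_nat_mul, ← Complex.exp_nat_mul, ← Complex.exp_add]
    congr 2
    push_cast
    ring
  rw [e, Complex.mul_re, h1, Complex.exp_ofReal_mul_I_im, zero_mul, zero_sub, neg_eq_zero] at h2
  have hsin := Real.sin_pos_of_pos_of_lt_pi (by positivity) hε2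
  rcases mul_eq_zero.1 h2 with h | h
  · exact hw (Complex.ext h1 h)
  · exact hsin.ne' h

/-- An entire function of finite order that grows at most polynomially in a dense set of
directions is a polynomial. -/
theorem HasExpGrowth.exists_polynomial {G : ℂ → ℂ} (hG : HasExpGrowth G)
    (h : ∀ x y : ℝ, x < y → ∃ t ∈ Ioo x y, HasPolyGrowthOnAngles G {t}) :
    ∃ p : ℂ[X], ∀ z, G z = p.eval z := by
  obtain ⟨dG, A, hA, m, hm⟩ := hG
  have hloc : ∀ t ∈ Icc (-Real.pi) Real.pi,
      ∃ s ∈ 𝓝[Icc (-Real.pi) Real.pi] t, HasPolyGrowthOnAngles G s := by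
    intro t _
    -- Two good directions within `ε` on either side of `t` bound a sector thin enough for
    -- Phragmén–Lindelöf.
    set ε := Real.pi / (2 * (m + 1)) with hε
    have hε0 : 0 < ε := by have := Real.pi_pos; positivity
    obtain ⟨α, hα, hαG⟩ := h (t - ε) t (by linarith)
    obtain ⟨β, hβ, hβG⟩ := h t (t + ε) (by linarith)
    obtain ⟨C, hC, k, hCk⟩ := hαG.union hβG
    refine ⟨Icc α β, mem_nhdsWithin_of_mem_nhds (Icc_mem_nhds hα.2 hβ.1),
      C * 2 ^ k, by positivity, k, fun ζ hζ => ?_⟩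
    refine norm_le_of_mem_sector dG hA hm (hα.2.trans hβ.1) ?_ hC
      (fun ζ hζ => hCk ζ (Or.inl hζ)) (fun ζ hζ => hCk ζ (Or.inr hζ)) hζ.1 hζ.2
    calc (β - α) * (m + 1) ≤ (2 * ε) * (m + 1) := by
          gcongr; linarith [hα.1, hβ.2]
      _ = Real.pi := by rw [hε]; field_simp
  -- Finitely many such sectors cover all arguments, so one bound holds in the whole plane.
  obtain ⟨C, hC, k, hCk⟩ : HasPolyGrowthOnAngles G (Icc (-Real.pi) Real.pi) :=
    isCompact_Icc.induction_on (p := HasPolyGrowthOnAngles G) ⟨0, le_rfl, 0, by simp⟩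
      (fun s t hst ⟨C, hC, k, hk⟩ => ⟨C, hC, k, fun ζ hζ => hk ζ (hst hζ)⟩)
      (fun s t hs ht => hs.union ht) hloc
  refine dG.exists_polynomial_of_norm_le (C := C + ‖G 0‖) (k := k) fun z => ?_
  rcases eq_or_ne z 0 with rfl | hz
  · simp [hC]
  · have := hCk (Complex.log z) ⟨(Complex.neg_pi_lt_log_im z).le, Complex.log_im_le_pi z⟩
    rw [Complex.exp_log hz, Complex.log_re, Real.exp_log (norm_pos_iff.2 hz)] at this
    refine this.trans ?_
    gcongr
    linarith [norm_nonneg (G 0)]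

/-! ### The linear equation has no nonzero entire solution of finite order -/

/-- A `d`-th root `u` of `conj a / |a|` gives `a u ^ d = |a|`. -/
theorem exists_norm_eq_one_re_mul_pow_pos {a : ℂ} (ha : a ≠ 0) {d : ℕ} (hd : 1 ≤ d) :
    ∃ u : ℂ, ‖u‖ = 1 ∧ 0 < (a * u ^ d).re := by
  obtain ⟨u, hu⟩ := IsAlgClosed.exists_pow_nat_eq (starRingEnd ℂ a / ‖a‖) (by omega : 0 < d)
  have hna : (‖a‖ : ℂ) ≠ 0 := by simpa using ha
  refine ⟨u, ?_, ?_⟩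
  · have : ‖u‖ ^ d = 1 := by
      rw [← norm_pow, hu, norm_div, RCLike.norm_conj, Complex.norm_real, norm_norm,
        div_self (by simpa using ha)]
    exact (pow_eq_one_iff_of_nonneg (norm_nonneg u) (by omega)).1 this
  · rw [hu, ← mul_div_assoc, Complex.mul_conj, Complex.normSq_eq_norm_sq]
    push_cast
    rw [sq, mul_div_cancel_right₀ _ hna, Complex.ofReal_re]
    simpa using ha

/-- A linear differential equation `D G' = (E + N e^q) G + S` with polynomial coefficients,
`deg E < deg D` and `q` nonconstant has no nonzero entire solution of finite order. -/
theorem HasExpGrowth.eq_zero_of_deriv_eq {G : ℂ → ℂ} (hG : HasExpGrowth G)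
    {D E N S q : ℂ[X]} (hD : D ≠ 0) (hED : E.degree < D.degree) (hN : N ≠ 0)
    (hd : 1 ≤ q.natDegree)
    (hode : ∀ z, D.eval z * deriv G z
      = (E.eval z + N.eval z * Complex.exp (q.eval z)) * G z + S.eval z) : ∀ z, G z = 0 := by
  have ha : q.leadingCoeff ≠ 0 := by
    rw [Polynomial.leadingCoeff_ne_zero]; rintro rfl; simp at hd
  obtain ⟨p, hp⟩ := hG.exists_polynomial fun x y hxy => by
    obtain ⟨t, ht, hne⟩ := exists_mem_Ioo_re_mul_exp_ne_zero ha hd hxy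
    refine ⟨t, ht, ?_⟩
    have hu : ‖Complex.exp (t * Complex.I)‖ = 1 := Complex.norm_exp_ofReal_mul_I t
    rcases hne.lt_or_gt with h | h
    · obtain ⟨C, k, hC⟩ := exists_eventually_norm_le_of_decay hG.1 hD hED hd hode hu h
      exact HasPolyGrowthOnAngles.singleton hG.1.continuous hC
    · have := eventually_norm_le_two_of_growth hG hN hd hode hu h
      exact HasPolyGrowthOnAngles.singleton (C := 2) (k := 0) hG.1.continuous (by simpa using this)
  have hGp : G = fun z => p.eval z := funext hp
  by_contra! hne
  have hp0 : p ≠ 0 := by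
    rintro rfl
    obtain ⟨z, hz⟩ := hne
    exact hz (by simp [hp])
  -- For `G = p`, the function `N p e^q` equals the polynomial `D p' - E p - S`, yet outgrows every
  -- power on a ray where `Re q → ∞`.
  obtain ⟨u, hu, hre⟩ := exists_norm_eq_one_re_mul_pow_pos ha hd
  obtain ⟨C, hC, k, hk⟩ := (D * Polynomial.derivative p - E * p - S).exists_norm_eval_le
  obtain ⟨r, hr, hr0⟩ := ((Polynomial.eventually_mul_pow_le_norm_mul_exp hd (mul_ne_zero hN hp0) hu
    hre (C + 1) k).and (eventually_ge_atTop 0)).exists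
  have h1 := hr (r * u) (mem_closedBall_self zero_le_one)
  have h2 := hk (r * u)
  have h3 := hode (r * u)
  rw [hGp, Polynomial.deriv] at h3
  have h4 : (D * Polynomial.derivative p - E * p - S).eval (r * u)
      = (N * p).eval (r * u) * Complex.exp (q.eval (r * u)) := by
    simp only [Polynomial.eval_sub, Polynomial.eval_mul]
    rw [h3]
    ring
  rw [h4, norm_mul (r : ℂ), hu, mul_one, Complex.norm_real, Real.norm_of_nonneg hr0] at h2
  have : (0 : ℝ) < (1 + r) ^ k := by positivity
  nlinarith

/-! ### From the Nevanlinna characteristic to the maximum modulus -/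

/-- This rests on `|R² - conj(i) w|² - R² |w - i|² = (R² - |i|²) (R² - |w|²)`. -/
theorem Complex.one_le_norm_canonicalFactor {R : ℝ} {i w : ℂ} (hi : i ∈ ball 0 R)
    (hw : w ∈ closedBall 0 R) (hne : w ≠ i) : 1 ≤ ‖Complex.canonicalFactor R i w‖ := by
  rw [mem_ball_zero_iff] at hi
  rw [mem_closedBall_zero_iff] at hw
  have hR : 0 < R := (norm_nonneg i).trans_lt hi
  have hpos : 0 < R * ‖w - i‖ := mul_pos hR (norm_pos_iff.2 (sub_ne_zero.2 hne))
  rw [Complex.canonicalFactor_apply, norm_div, norm_mul, Complex.norm_real,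
    Real.norm_of_nonneg hR.le, one_le_div hpos]
  refine (sq_le_sq₀ hpos.le (norm_nonneg _)).1 ?_
  have h1 : ‖i‖ ^ 2 ≤ R ^ 2 := pow_le_pow_left₀ (norm_nonneg _) hi.le 2
  have h2 : ‖w‖ ^ 2 ≤ R ^ 2 := pow_le_pow_left₀ (norm_nonneg _) hw 2
  have h3 : 0 ≤ (R ^ 2 - ‖i‖ ^ 2) * (R ^ 2 - ‖w‖ ^ 2) :=
    mul_nonneg (sub_nonneg.2 h1) (sub_nonneg.2 h2)
  rw [mul_pow]
  rw [Complex.sq_norm, Complex.sq_norm, Complex.normSq_apply, Complex.normSq_apply] at h3 ⊢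
  simp only [Complex.sub_re, Complex.sub_im, Complex.mul_re, Complex.mul_im, Complex.conj_re,
    Complex.conj_im, ← Complex.ofReal_pow, Complex.ofReal_re, Complex.ofReal_im]
  nlinarith

/-- **Poisson–Jensen inequality** for entire functions without zeros on the circle. -/
theorem Differentiable.log_norm_le_circleAverage_posLog {G : ℂ → ℂ} (dG : Differentiable ℂ G)
    {R : ℝ} (hR : 0 < R) (hne : ∀ z ∈ sphere (0 : ℂ) R, G z ≠ 0) {w : ℂ} (hw : w ∈ ball 0 R) :
    Real.log ‖G w‖ ≤ (R + ‖w‖) / (R - ‖w‖) * proximity G ⊤ R := by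
  have hwR := mem_ball_zero_iff.1 hw
  have hK : 0 ≤ (R + ‖w‖) / (R - ‖w‖) := div_nonneg (by positivity) (by linarith)
  -- Since `Real.log 0 = 0`, a zero of `G` only requires the right side to be nonnegative.
  rcases eq_or_ne (G w) 0 with h0 | h0
  · rw [h0, norm_zero, Real.log_zero]
    exact mul_nonneg hK (proximity_nonneg R)
  have hmer : Meromorphic G := fun z => (dG.analyticAt z).meromorphicAt
  have hord : ∀ {z : ℂ}, G z ≠ 0 → meromorphicOrderAt G z = 0 := fun {z} hz =>
    (dG.analyticAt z).meromorphicNFAt.meromorphicOrderAt_eq_zero_iff.2 hz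
  have htop : ∀ z, meromorphicOrderAt G z ≠ ⊤ := fun z =>
    hmer.meromorphicOn.meromorphicOrderAt_ne_top_of_isPreconnected isPreconnected_univ
      (mem_univ w) (mem_univ z) (by rw [hord h0]; exact WithTop.zero_ne_top)
  -- Multiplying `G` by its canonical factors yields a zero-free `h` with `|h| = |G|` on the circle
  -- and `|h| ≥ |G|` inside, so Poisson's formula for the harmonic `log |h|` suffices.
  obtain ⟨h, D⟩ := (hmer.meromorphicOn (s := closedBall 0 R)).exists_ecanonicalDecomp
    (fun u => htop u)
  have hsphere : ∀ i, MeromorphicOn.divisor G (sphere 0 R) i = 0 := by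
    intro i
    by_cases hi : i ∈ sphere (0 : ℂ) R
    · rw [MeromorphicOn.divisor_apply hmer.meromorphicOn hi, hord (hne i hi)]; rfl
    · exact Function.locallyFinsuppWithin.apply_eq_zero_of_notMem _ hi
  have hlog : ∀ z ∈ closedBall (0 : ℂ) R, G z ≠ 0 → Real.log ‖h z‖
      = (∑ᶠ i, (MeromorphicOn.divisor G (ball 0 R) i) * Real.log ‖Complex.canonicalFactor R i z‖)
        + Real.log ‖G z‖ := by
    intro z hz hz0
    rw [D.log_norm_eq hz (hord hz0) hR,
      (dG.analyticAt z).meromorphicTrailingCoeffAt_of_ne_zero hz0]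
    simp [hsphere]
  have hsph : ∀ z ∈ sphere (0 : ℂ) R, Real.log ‖h z‖ = Real.log ‖G z‖ := by
    intro z hz
    rw [hlog z (sphere_subset_closedBall hz) (hne z hz), finsum_eq_zero_of_forall_eq_zero, zero_add]
    intro i
    by_cases hi : i ∈ ball (0 : ℂ) R
    · rw [Complex.norm_canonicalFactor_eval_circle_eq_one hi hz, Real.log_one, mul_zero]
    · simp [Function.locallyFinsuppWithin.apply_eq_zero_of_notMem _ hi]
  have hGh : Real.log ‖G w‖ ≤ Real.log ‖h w‖ := by
    rw [hlog w (ball_subset_closedBall hw) h0, le_add_iff_nonneg_left]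
    refine finsum_nonneg fun i => ?_
    by_cases hi : i ∈ ball (0 : ℂ) R
    · refine mul_nonneg ?_ ?_
      · have : 0 ≤ MeromorphicOn.divisor G (ball 0 R) i :=
          MeromorphicOn.AnalyticOnNhd.divisor_nonneg (fun z _ => dG.analyticAt z) i
        exact_mod_cast this
      · rcases eq_or_ne w i with rfl | hwi
        · simp
        · exact Real.log_nonneg
            (Complex.one_le_norm_canonicalFactor hi (ball_subset_closedBall hw) hwi)
    · simp [Function.locallyFinsuppWithin.apply_eq_zero_of_notMem _ hi]
  refine hGh.trans ?_
  have hharm : InnerProductSpace.HarmonicOnNhd (fun z => Real.log ‖h z‖) (closedBall 0 R) :=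
    fun z hz => (D.analyticOnNhd z hz).harmonicAt_log_norm (D.ne_zero z hz)
  rw [← hharm.circleAverage_re_herglotzRieszKernel_smul hw, proximity_top, ← smul_eq_mul,
    ← Real.circleAverage_smul]
  have habs : |R| = R := abs_of_pos hR
  refine Real.circleAverage_mono ?_ ?_ ?_
  · refine ContinuousOn.circleIntegrable hR.le ?_
    have hk := continuousOn_herglotzRieszKernel_sphere hw
    rw [habs] at hk
    refine (Complex.continuous_re.comp_continuousOn hk).smul ?_
    refine ContinuousOn.log ?_ fun z hz =>
      norm_ne_zero_iff.2 (D.ne_zero z (sphere_subset_closedBall hz))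
    exact (D.analyticOnNhd.continuousOn.mono sphere_subset_closedBall).norm
  · exact (hmer.meromorphicOn.circleIntegrable_posLog_norm (c := 0) (R := R)).const_mul _
  · intro z hz
    rw [habs] at hz
    have h1 := re_herglotzRieszKernel_le hz hw
    have h2 := le_re_herglotzRieszKernel hz hw
    simp only [sub_zero] at h1 h2
    simp only [Pi.smul_apply', Pi.smul_apply, Function.comp_apply, smul_eq_mul,
      herglotzRieszKernel_def, sub_zero, hsph z hz]
    have h3 : 0 ≤ ((z + w) / (z - w)).re := le_trans (div_nonneg (by linarith) (by positivity)) h2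
    calc ((z + w) / (z - w)).re * Real.log ‖G z‖
        ≤ ((z + w) / (z - w)).re * Real.posLog ‖G z‖ :=
          mul_le_mul_of_nonneg_left (le_max_right _ _) h3
      _ ≤ _ := mul_le_mul_of_nonneg_right h1 Real.posLog_nonneg

/-- An entire function whose proximity function grows at most like a power has finite order in
the sense of maximum modulus. -/
theorem Differentiable.hasExpGrowth_of_proximity_le {G : ℂ → ℂ} (dG : Differentiable ℂ G)
    {C : ℝ} {n : ℕ} (h : ∀ᶠ r : ℝ in atTop, proximity G ⊤ r ≤ C * r ^ n) : HasExpGrowth G := by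
  obtain ⟨r₀, hr₀⟩ := eventually_atTop.1 h
  obtain ⟨B, hB⟩ := (isCompact_closedBall (0 : ℂ) (|r₀| + 1)).exists_bound_of_continuousOn
    dG.continuous.continuousOn
  have hB0 : 0 ≤ B := (norm_nonneg _).trans (hB 0 (by simp; positivity))
  refine ⟨dG, B + 3 * (|C| * 3 ^ n), by positivity, n, fun z => ?_⟩
  have h1 : (1 : ℝ) ≤ (1 + ‖z‖) ^ n := one_le_pow₀ (by linarith [norm_nonneg z])
  have hA : 0 ≤ |C| * 3 ^ n := by positivity
  rcases le_or_gt ‖z‖ (|r₀| + 1) with hz | hz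
  · refine (hB z (by simpa using hz)).trans ?_
    refine (by linarith [Real.add_one_le_exp B] : B ≤ Real.exp B).trans (Real.exp_le_exp.2 ?_)
    nlinarith
  rcases eq_or_ne (G z) 0 with h0 | h0
  · rw [h0, norm_zero]; positivity
  have hz0 : 0 < ‖z‖ := by linarith [abs_nonneg r₀]
  -- Only finitely many radii meet zeros of `G`; `R > 2‖z‖` bounds the kernel factor by `3`, and `R
  -- < 3‖z‖` keeps the power of `R` under control.
  obtain ⟨R, hR, hRne⟩ : ∃ R ∈ Ioo (2 * ‖z‖) (3 * ‖z‖), ∀ w ∈ sphere (0 : ℂ) R, G w ≠ 0 := by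
    have hmer : MeromorphicOn G (closedBall 0 (3 * ‖z‖)) :=
      fun w _ => (dG.analyticAt w).meromorphicAt
    have hfin := (MeromorphicOn.divisor G (closedBall 0 (3 * ‖z‖))).finiteSupport
      (isCompact_closedBall _ _)
    have hinf : (Ioo (2 * ‖z‖) (3 * ‖z‖)).Infinite := Ioo_infinite (by linarith)
    obtain ⟨R, hR, hRn⟩ := (hinf.sdiff (hfin.image (‖·‖))).nonempty
    refine ⟨R, hR, fun w hw hw0 => hRn ⟨w, ?_, mem_sphere_zero_iff_norm.1 hw⟩⟩
    have hwb : w ∈ closedBall (0 : ℂ) (3 * ‖z‖) := by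
      rw [mem_closedBall_zero_iff, mem_sphere_zero_iff_norm.1 hw]; exact hR.2.le
    have htop : meromorphicOrderAt G w ≠ ⊤ := by
      have hmer' : MeromorphicOn G univ := fun w _ => (dG.analyticAt w).meromorphicAt
      refine hmer'.meromorphicOrderAt_ne_top_of_isPreconnected isPreconnected_univ
        (mem_univ z) (mem_univ w) ?_
      rw [(dG.analyticAt z).meromorphicNFAt.meromorphicOrderAt_eq_zero_iff.2 h0]
      exact WithTop.zero_ne_top
    rw [Function.mem_support, MeromorphicOn.divisor_apply hmer hwb]
    intro hzero
    have : meromorphicOrderAt G w = 0 := by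
      rcases WithTop.untop₀_eq_zero.1 hzero with h | h
      · exact h
      · exact absurd h htop
    exact (dG.analyticAt w).meromorphicNFAt.meromorphicOrderAt_eq_zero_iff.1 this hw0
  have hRpos : 0 < R := by linarith [hR.1]
  have hkey := dG.log_norm_le_circleAverage_posLog hRpos hRne (w := z)
    (by rw [mem_ball_zero_iff]; linarith [hR.1])
  have hK : (R + ‖z‖) / (R - ‖z‖) ≤ 3 := by
    rw [div_le_iff₀ (by linarith [hR.1])]; linarith [hR.1]
  have hprox : proximity G ⊤ R ≤ |C| * 3 ^ n * (1 + ‖z‖) ^ n := by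
    refine (hr₀ R (by linarith [hR.1, le_abs_self r₀])).trans ?_
    rw [mul_assoc, ← mul_pow]
    gcongr
    · exact le_abs_self C
    · linarith [hR.2]
  rw [← Real.log_le_iff_le_exp (norm_pos_iff.2 h0)]
  refine hkey.trans ?_
  calc (R + ‖z‖) / (R - ‖z‖) * proximity G ⊤ R ≤ 3 * (|C| * 3 ^ n * (1 + ‖z‖) ^ n) := by
        gcongr
        exact proximity_nonneg R
    _ ≤ _ := by nlinarith

theorem HasExpGrowth.exists_proximity_le {G : ℂ → ℂ} (hG : HasExpGrowth G) :
    ∃ C : ℝ, ∃ n : ℕ, ∀ᶠ r : ℝ in atTop, proximity G ⊤ r ≤ C * r ^ n := by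
  obtain ⟨dG, A, hA, m, hm⟩ := hG
  refine ⟨A * 2 ^ m, m, ?_⟩
  filter_upwards [eventually_ge_atTop 1] with r hr
  rw [proximity_top]
  have hmer : Meromorphic G := fun z => (dG.analyticAt z).meromorphicAt
  refine Real.circleAverage_mono_on_of_le_circle
    (hmer.meromorphicOn.circleIntegrable_posLog_norm) fun z hz => ?_
  rw [mem_sphere_zero_iff_norm, abs_of_pos (by linarith)] at hz
  have h1 := Real.posLog_le_posLog (norm_nonneg _) (hm z)
  refine h1.trans ?_
  rw [Real.posLog_eq_log (by rw [abs_of_pos (Real.exp_pos _)]; exact Real.one_le_exp (by positivity)),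
    Real.log_exp, hz, mul_assoc, ← mul_pow]
  gcongr
  linarith

theorem HasFiniteOrder.exists_characteristic_le {f : ℂ → ℂ} (hf : HasFiniteOrder f) :
    ∃ n : ℕ, ∀ᶠ r : ℝ in atTop, characteristic f ⊤ r ≤ r ^ n := by
  obtain ⟨c, hc1, -⟩ := EReal.lt_iff_exists_real_btwn.1 hf
  refine ⟨⌈c⌉₊, ?_⟩
  filter_upwards [eventually_lt_of_limsup_lt hc1, eventually_gt_atTop 1] with r hr hr1
  have hlog := Real.log_pos hr1
  have h1 : Real.posLog (characteristic f ⊤ r) / Real.log r < c := by exact_mod_cast hr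
  rw [div_lt_iff₀ hlog] at h1
  have h2 : Real.posLog (characteristic f ⊤ r) ≤ ⌈c⌉₊ * Real.log r :=
    h1.le.trans (by gcongr; exact Nat.le_ceil c)
  rcases le_or_gt (characteristic f ⊤ r) 0 with h0 | h0
  · exact h0.trans (by positivity)
  · have h3 := (le_max_right 0 (Real.log (characteristic f ⊤ r))).trans h2
    rwa [← Real.log_pow, Real.log_le_log_iff h0 (by positivity)] at h3

/-! ### Equality off discrete sets, and clearing finitely many poles -/

theorem eventually_codiscrete_iff {X : Type*} [TopologicalSpace X] {p : X → Prop} :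
    (∀ᶠ z in codiscrete X, p z) ↔ ∀ x, ∀ᶠ z in 𝓝[≠] x, p z := by
  rw [Filter.Eventually, mem_codiscrete]
  simp only [disjoint_principal_right, compl_compl]
  rfl

protected theorem MerEq.deriv {f g : ℂ → ℂ} (h : MerEq f g) : MerEq (deriv f) (deriv g) :=
  eventually_codiscrete_iff.2 fun x =>
    EventuallyEq.nhdsNE_deriv (eventually_codiscrete_iff.1 h x)

theorem MerEq.eq_of_continuous {f g : ℂ → ℂ} (h : MerEq f g) (hf : Continuous f)
    (hg : Continuous g) : f = g := by
  funext x
  have h1 : Tendsto f (𝓝[≠] x) (𝓝 (f x)) := (hf.tendsto x).mono_left nhdsWithin_le_nhds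
  have h2 : Tendsto g (𝓝[≠] x) (𝓝 (g x)) := (hg.tendsto x).mono_left nhdsWithin_le_nhds
  exact tendsto_nhds_unique (h1.congr' (eventually_codiscrete_iff.1 h x)) h2

theorem Polynomial.eventually_codiscrete_eval_ne_zero {p : ℂ[X]} (hp : p ≠ 0) :
    ∀ᶠ z in codiscrete ℂ, p.eval z ≠ 0 := by
  have := (Polynomial.finite_setOfPred_isRoot hp).compl_mem_codiscrete
  filter_upwards [this] with z hz using hz

/-- A meromorphic function of finite order with finitely many poles is the quotient of an entire
function of finite order by a polynomial. -/
theorem HasFiniteOrder.exists_eq_div_polynomial {f : ℂ → ℂ} (hf : Meromorphic f)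
    (hpoles : {z | IsPoleOf f z}.Finite) (hord : HasFiniteOrder f) :
    ∃ P : ℂ[X], P ≠ 0 ∧ ∃ G : ℂ → ℂ, HasExpGrowth G ∧ MerEq f (fun z => G z / P.eval z) := by
  set k : ℂ → ℕ := fun a => (-(meromorphicOrderAt f a).untop₀).toNat
  set P : ℂ[X] := ∏ a ∈ hpoles.toFinset, (Polynomial.X - Polynomial.C a) ^ k a with hP
  have hP0 : P ≠ 0 := Finset.prod_ne_zero_iff.2 fun a _ => pow_ne_zero _ (Polynomial.X_sub_C_ne_zero a)
  have hPmer : Meromorphic (fun z => P.eval z) :=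
    fun z => (P.differentiable.analyticAt z).meromorphicAt
  set φ : ℂ → ℂ := (fun z => P.eval z) * f
  have hφ : Meromorphic φ := hPmer.mul hf
  have hφord : ∀ x, 0 ≤ meromorphicOrderAt φ x := by
    intro x
    rw [meromorphicOrderAt_mul (hPmer x) (hf x)]
    by_cases hx : IsPoleOf f x
    · obtain ⟨Q, hQ⟩ : (Polynomial.X - Polynomial.C x) ^ k x ∣ P :=
        Finset.dvd_prod_of_mem _ (by simpa using hx)
      have e : (fun z => P.eval z) = ((· - x) ^ (k x : ℤ)) * fun z => Q.eval z := by
        funext z; rw [hQ]; simp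
      have hQ0 : 0 ≤ meromorphicOrderAt (fun z => Q.eval z) x :=
        (Q.differentiable.analyticAt x).meromorphicOrderAt_nonneg
      have hx' : meromorphicOrderAt f x < 0 := hx
      obtain ⟨n, hn⟩ := WithTop.ne_top_iff_exists.1 hx'.ne_top
      rw [← hn] at hx'
      have hn0 : n < 0 := by exact_mod_cast hx'
      have hk : (k x : ℤ) = -n := by
        simp only [k, ← hn, WithTop.untop₀_coe]
        omega
      rw [e, meromorphicOrderAt_mul (by fun_prop) (Q.differentiable.analyticAt x).meromorphicAt,
        meromorphicOrderAt_zpow_id_sub_const, hk, ← hn]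
      calc (0 : WithTop ℤ) = ((-n : ℤ) : WithTop ℤ) + 0 + (n : WithTop ℤ) := by
            rw [add_zero, ← WithTop.coe_add]; simp
        _ ≤ _ := by gcongr
    · exact add_nonneg (P.differentiable.analyticAt x).meromorphicOrderAt_nonneg (not_lt.1 hx)
  set G := toMeromorphicNFOn φ univ
  have hGφ : φ =ᶠ[codiscrete ℂ] G := toMeromorphicNFOn_eqOn_codiscrete hφ.meromorphicOn
  have dG : Differentiable ℂ G := fun x => by
    refine AnalyticAt.differentiableAt ?_
    rw [← (meromorphicNFOn_toMeromorphicNFOn φ univ (mem_univ x)).meromorphicOrderAt_nonneg_iff_analyticAt,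
      meromorphicOrderAt_toMeromorphicNFOn hφ.meromorphicOn (mem_univ x)]
    exact hφord x
  refine ⟨P, hP0, G, ?_, ?_⟩
  · obtain ⟨n, hn⟩ := hord.exists_characteristic_le
    obtain ⟨C, l, hC⟩ := P.hasExpGrowth.exists_proximity_le
    refine dG.hasExpGrowth_of_proximity_le (C := |C| + 1) (n := l + n) ?_
    filter_upwards [hn, hC, eventually_ge_atTop 1] with r h1 h2 hr
    rw [← proximity_congr_codiscrete hGφ (by linarith)]
    refine (proximity_mul_top_le hPmer hf r).trans ?_
    have h3 : proximity f ⊤ r ≤ r ^ n :=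
      le_trans (le_add_of_nonneg_right (logCounting_nonneg hr)) h1
    calc proximity (fun z => P.eval z) ⊤ r + proximity f ⊤ r ≤ C * r ^ l + r ^ n := add_le_add h2 h3
      _ ≤ |C| * r ^ (l + n) + 1 * r ^ (l + n) := by
        rw [one_mul]
        gcongr
        · exact le_abs_self C
        · omega
        · omega
      _ = _ := by ring
  · filter_upwards [hGφ, Polynomial.eventually_codiscrete_eval_ne_zero hP0] with z h1 h2
    rw [← h1]
    simp only [φ, Pi.mul_apply]
    field_simp

/-! ### Zero-free entire functions of finite order -/

/-- An entire quotient of entire functions of finite order has finite order. -/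
theorem HasExpGrowth.of_mul_eq {K H₁ H₂ : ℂ → ℂ} (dK : Differentiable ℂ K)
    (h₁ : HasExpGrowth H₁) (h₂ : HasExpGrowth H₂) (hne : ∃ z, H₂ z ≠ 0)
    (h : ∀ z, K z * H₂ z = H₁ z) : HasExpGrowth K := by
  have hm₁ : Meromorphic H₁ := fun z => (h₁.1.analyticAt z).meromorphicAt
  have hm₂ : Meromorphic H₂ := fun z => (h₂.1.analyticAt z).meromorphicAt
  have hco : ∀ᶠ z in codiscrete ℂ, H₂ z ≠ 0 := by
    obtain ⟨z₀, hz₀⟩ := hne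
    refine (hm₂.meromorphicOn (s := univ)).eventually_codiscreteWithin_apply_ne_zero fun x hx =>
      hm₂.meromorphicOn.meromorphicOrderAt_ne_top_of_isPreconnected isPreconnected_univ
        (mem_univ z₀) hx ?_
    rw [(h₂.1.analyticAt z₀).meromorphicNFAt.meromorphicOrderAt_eq_zero_iff.2 hz₀]
    exact WithTop.zero_ne_top
  have hK : K =ᶠ[codiscrete ℂ] H₁ * H₂⁻¹ := by
    filter_upwards [hco] with z hz
    simp only [Pi.mul_apply, Pi.inv_apply, ← h z]
    field_simp
  obtain ⟨C₁, n₁, hC₁⟩ := h₁.exists_proximity_le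
  obtain ⟨C₂, n₂, hC₂⟩ := h₂.exists_proximity_le
  -- `c` is the error in the first main theorem comparing `T(r, H₂)` with `T(r, 1/H₂)`; as `H₂` is
  -- entire, `T(r, H₂)` is just its proximity function.
  set c := max |Real.log ‖H₂ 0‖| |Real.log ‖meromorphicTrailingCoeffAt H₂ 0‖|
  have hc : 0 ≤ c := le_max_of_le_left (abs_nonneg _)
  refine dK.hasExpGrowth_of_proximity_le (C := |C₁| + |C₂| + c) (n := n₁ + n₂) ?_
  filter_upwards [hC₁, hC₂, eventually_ge_atTop 1] with r g1 g2 hr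
  rw [proximity_congr_codiscrete hK (by linarith)]
  refine (proximity_mul_top_le hm₁ hm₂.inv r).trans ?_
  have hlc : logCounting H₂ ⊤ r = 0 := by
    have hdiv : 0 ≤ MeromorphicOn.divisor H₂ univ :=
      MeromorphicOn.AnalyticOnNhd.divisor_nonneg fun z _ => h₂.1.analyticAt z
    rw [logCounting_top, negPart_eq_zero.2 hdiv]
    simp
  have h3 : proximity H₂⁻¹ ⊤ r ≤ characteristic H₂⁻¹ ⊤ r :=
    le_add_of_nonneg_right (logCounting_nonneg hr)
  have h4 := (abs_le.1 (characteristic_sub_characteristic_inv_le hm₂ (R := r))).1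
  have h5 : characteristic H₂ ⊤ r = proximity H₂ ⊤ r := by
    simp only [characteristic, Pi.add_apply, hlc, add_zero]
  have hp1 : r ^ n₁ ≤ r ^ (n₁ + n₂) := pow_le_pow_right₀ hr (by omega)
  have hp2 : r ^ n₂ ≤ r ^ (n₁ + n₂) := pow_le_pow_right₀ hr (by omega)
  have hp3 : 1 ≤ r ^ (n₁ + n₂) := one_le_pow₀ hr
  have e1 : C₁ * r ^ n₁ ≤ |C₁| * r ^ (n₁ + n₂) := by
    gcongr; exact le_abs_self _
  have e2 : C₂ * r ^ n₂ ≤ |C₂| * r ^ (n₁ + n₂) := by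
    gcongr; exact le_abs_self _
  have e3 : c ≤ c * r ^ (n₁ + n₂) := le_mul_of_one_le_right hc hp3
  simp only [Pi.add_apply] at *
  linarith

/-- A primitive `g` of `K' / K` makes `K e^(-g)` constant; a logarithm of that constant is added to
`g`. -/
theorem exists_eq_exp_of_differentiable {K : ℂ → ℂ} (dK : Differentiable ℂ K) (hK : ∀ z, K z ≠ 0) :
    ∃ g : ℂ → ℂ, Differentiable ℂ g ∧ ∀ z, K z = Complex.exp (g z) := by
  have hd : Differentiable ℂ fun z => deriv K z / K z := fun z =>
    (dK.contDiff.differentiable_deriv_two z).div (dK z) (hK z)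
  obtain ⟨g, hg⟩ := hd.isExactOn_univ
  have hg' : ∀ z, HasDerivAt g (deriv K z / K z) z := fun z => hg z (mem_univ z)
  have dg : Differentiable ℂ g := fun z => (hg' z).differentiableAt
  have hconst : ∀ z, K z * Complex.exp (-g z) = K 0 * Complex.exp (-g 0) := fun z => by
    refine is_const_of_deriv_eq_zero (f := fun z => K z * Complex.exp (-g z)) (by fun_prop)
      (fun z => ?_) z 0
    refine ((dK z).hasDerivAt.mul (hg' z).neg.cexp).deriv.trans ?_
    have := hK z
    simp only [Pi.neg_apply]
    field_simp
    ring
  have hc : K 0 * Complex.exp (-g 0) ≠ 0 := mul_ne_zero (hK 0) (Complex.exp_ne_zero _)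
  refine ⟨fun z => g z + Complex.log (K 0 * Complex.exp (-g 0)), by fun_prop, fun z => ?_⟩
  rw [Complex.exp_add, Complex.exp_log hc, ← hconst z, mul_comm (K z), ← mul_assoc,
    ← Complex.exp_add]
  simp

/-- Finite order bounds `Re g` by a polynomial, and Borel–Carathéodory on radius `2‖z‖ + 1`
transfers the bound to `|g|`. -/
theorem HasExpGrowth.exists_polynomial_of_exp {g : ℂ → ℂ} (dg : Differentiable ℂ g)
    (h : HasExpGrowth fun z => Complex.exp (g z)) : ∃ p : ℂ[X], ∀ z, g z = p.eval z := by
  obtain ⟨-, A, hA, m, hm⟩ := h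
  refine dg.exists_polynomial_of_norm_le (C := 2 * (A * 2 ^ m + 1) + 3 * ‖g 0‖) (k := m)
    fun z => ?_
  have hre : ∀ w, (g w).re ≤ A * (1 + ‖w‖) ^ m := fun w => by
    have := hm w
    rwa [Complex.norm_exp, Real.exp_le_exp] at this
  set R := 2 * ‖z‖ + 1
  have hz := norm_nonneg z
  set M := A * (1 + R) ^ m + 1
  have hM : 0 < M := by positivity
  have hbc := Complex.borelCaratheodory (f := g) (R := R) (M := M) hM dg.differentiableOn
    (fun w hw => by
      rw [mem_ball_zero_iff] at hw
      refine (hre w).trans ?_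
      simp only [M]
      have : (1 + ‖w‖) ^ m ≤ (1 + R) ^ m := by gcongr
      nlinarith) (by positivity) (z := z) (by rw [mem_ball_zero_iff]; simp only [R]; linarith)
  have hRz : 0 < R - ‖z‖ := by simp only [R]; linarith
  have h1 : 2 * M * ‖z‖ / (R - ‖z‖) ≤ 2 * M := by
    rw [div_le_iff₀ hRz]
    gcongr
    simp only [R]; linarith
  have h2 : ‖g 0‖ * (R + ‖z‖) / (R - ‖z‖) ≤ ‖g 0‖ * 3 := by
    rw [mul_div_assoc]
    gcongr
    rw [div_le_iff₀ hRz]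
    simp only [R]; linarith
  have h3 : (1 : ℝ) ≤ (1 + ‖z‖) ^ m := one_le_pow₀ (by linarith)
  have h4 : (1 + R) ^ m = 2 ^ m * (1 + ‖z‖) ^ m := by
    rw [← mul_pow]; congr 1; simp only [R]; ring
  calc ‖g z‖ ≤ 2 * M + ‖g 0‖ * 3 := by linarith
    _ ≤ 2 * (A * 2 ^ m * (1 + ‖z‖) ^ m + (1 + ‖z‖) ^ m) + 3 * ‖g 0‖ * (1 + ‖z‖) ^ m := by
      have h5 : M = A * 2 ^ m * (1 + ‖z‖) ^ m + 1 := by simp only [M, h4]; ring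
      have h6 : 3 * ‖g 0‖ ≤ 3 * ‖g 0‖ * (1 + ‖z‖) ^ m :=
        le_mul_of_one_le_right (by positivity) h3
      rw [h5]
      linarith
    _ = _ := by ring

/-! ### Part (i) -/

theorem deriv_eventuallyEq_of_eq_div {F G : ℂ → ℂ} {P : ℂ[X]} (hP : P ≠ 0)
    (dG : Differentiable ℂ G) (h : MerEq F (fun z => G z / P.eval z)) :
    MerEq (deriv F) (fun z =>
      (deriv G z * P.eval z - G z * P.derivative.eval z) / P.eval z ^ 2) := by
  filter_upwards [h.deriv, Polynomial.eventually_codiscrete_eval_ne_zero hP] with z h1 h2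
  rw [h1]
  exact ((dG z).hasDerivAt.div (P.hasDerivAt z) h2).deriv

/-- Multiplying the equation for `G / P` by `b₁ b₂ P²` gives the polynomial form with `D = b₁ b₂ P`
and `E = b₁ b₂ P'`; the degree gap is `deg P' < deg P`. -/
theorem HasExpGrowth.eq_zero_of_div_deriv_eq {F G : ℂ → ℂ} (hG : HasExpGrowth G)
    {P a₁ b₁ a₂ b₂ q : ℂ[X]} (hP : P ≠ 0) (ha₁ : a₁ ≠ 0) (hb₁ : b₁ ≠ 0) (hb₂ : b₂ ≠ 0)
    (hq : 1 ≤ q.natDegree) (hF : MerEq F (fun z => G z / P.eval z))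
    (hode : MerEq (deriv F) (fun z =>
      a₁.eval z / b₁.eval z * Complex.exp (q.eval z) * F z + a₂.eval z / b₂.eval z)) :
    ∀ z, G z = 0 := by
  have dG := hG.1
  have hdeg : (b₁ * b₂ * Polynomial.derivative P).degree < (b₁ * b₂ * P).degree := by
    have hb : b₁ * b₂ ≠ 0 := mul_ne_zero hb₁ hb₂
    by_cases hP' : Polynomial.derivative P = 0
    · rw [hP', mul_zero, Polynomial.degree_zero]
      exact bot_lt_iff_ne_bot.2 (Polynomial.degree_ne_bot.2 (mul_ne_zero hb hP))
    · rw [Polynomial.degree_mul (p := b₁ * b₂), Polynomial.degree_mul (p := b₁ * b₂)]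
      exact WithBot.add_lt_add_left (Polynomial.degree_ne_bot.2 hb)
        (Polynomial.degree_derivative_lt hP)
  refine hG.eq_zero_of_deriv_eq (D := b₁ * b₂ * P) (E := b₁ * b₂ * Polynomial.derivative P)
    (N := a₁ * b₂ * P) (S := a₂ * b₁ * P ^ 2) (q := q)
    (mul_ne_zero (mul_ne_zero hb₁ hb₂) hP) hdeg (mul_ne_zero (mul_ne_zero ha₁ hb₂) hP) hq ?_
  refine congrFun (MerEq.eq_of_continuous ?_ ?_ ?_)
  · filter_upwards [hF, deriv_eventuallyEq_of_eq_div hP dG hF, hode,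
      Polynomial.eventually_codiscrete_eval_ne_zero hP,
      Polynomial.eventually_codiscrete_eval_ne_zero hb₁,
      Polynomial.eventually_codiscrete_eval_ne_zero hb₂] with z h1 h2 h3 h4 h5 h6
    rw [h3, h1] at h2
    field_simp at h2
    simp only [Polynomial.eval_mul, Polynomial.eval_pow]
    linear_combination -h2
  · have : Continuous (deriv G) := (hG.deriv).1.continuous
    fun_prop
  · have := dG.continuous
    fun_prop

/-- At a pole, differentiation lowers the order by exactly one, while `A F + B` has order at least
that of `F`. -/
theorem not_isPoleOf_of_deriv_eq {F A B : ℂ → ℂ} {x : ℂ} (hF : MeromorphicAt F x)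
    (hA : AnalyticAt ℂ A x) (hB : AnalyticAt ℂ B x)
    (h : deriv F =ᶠ[𝓝[≠] x] fun z => A z * F z + B z) : ¬ IsPoleOf F x := by
  intro hx
  have hx' : meromorphicOrderAt F x < 0 := hx
  obtain ⟨n, hn⟩ := WithTop.ne_top_iff_exists.1 hx'.ne_top
  rw [← hn] at hx'
  have hn0 : n < 0 := by exact_mod_cast hx'
  have h1 : meromorphicOrderAt (deriv F) x = ((n - 1 : ℤ) : WithTop ℤ) :=
    meromorphicOrderAt_deriv_eq_sub_one (by exact_mod_cast hn0.ne) hn.symm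
  rw [meromorphicOrderAt_congr h] at h1
  have h2 := meromorphicOrderAt_add (f₁ := A * F) (f₂ := B) (hA.meromorphicAt.mul hF)
    hB.meromorphicAt
  rw [meromorphicOrderAt_mul hA.meromorphicAt hF, ← hn,
    show A * F + B = fun z => A z * F z + B z from rfl, h1] at h2
  have h3 : (n : WithTop ℤ) ≤ min (meromorphicOrderAt A x + n) (meromorphicOrderAt B x) :=
    le_min (le_add_of_nonneg_left hA.meromorphicOrderAt_nonneg)
      (hx'.le.trans hB.meromorphicOrderAt_nonneg)
  have h4 : n ≤ n - 1 := by exact_mod_cast h3.trans h2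
  omega

theorem RatFunc.eval_id_eq (R : RatFunc ℂ) (z : ℂ) :
    R.eval (RingHom.id ℂ) z = R.num.eval z / R.denom.eval z := by
  simp [RatFunc.eval, Polynomial.eval₂_id]

theorem isConst_of_deriv_eq_ratFunc_mul_exp {R₁ R₂ : RatFunc ℂ} {q : ℂ[X]} {F : ℂ → ℂ}
    (hR₁ : R₁ ≠ 0) (hF : Meromorphic F) (hnc : ¬ ∃ c : ℂ, MerEq F fun _ => c)
    (hord : HasFiniteOrder F)
    (hode : MerEq (deriv F) fun z =>
      R₁.eval (RingHom.id ℂ) z * Complex.exp (q.eval z) * F z + R₂.eval (RingHom.id ℂ) z) :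
    ∃ c : ℂ, q = Polynomial.C c := by
  simp only [RatFunc.eval_id_eq] at hode
  have hb₁ := R₁.denom_ne_zero
  have hb₂ := R₂.denom_ne_zero
  have hpoles : {z | IsPoleOf F z}.Finite := by
    refine (Polynomial.finite_setOfPred_isRoot (mul_ne_zero hb₁ hb₂)).subset fun x hx => ?_
    by_contra hx'
    have hx' : (R₁.denom * R₂.denom).eval x ≠ 0 := hx'
    rw [Polynomial.eval_mul] at hx'
    refine not_isPoleOf_of_deriv_eq (hF x) (A := fun z =>
      R₁.num.eval z / R₁.denom.eval z * Complex.exp (q.eval z))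
      (B := fun z => R₂.num.eval z / R₂.denom.eval z) ?_ ?_
      (eventually_codiscrete_iff.1 hode x) hx
    · exact ((R₁.num.differentiable.analyticAt x).div (R₁.denom.differentiable.analyticAt x)
        (left_ne_zero_of_mul hx')).mul (q.differentiable.analyticAt x).cexp
    · exact (R₂.num.differentiable.analyticAt x).div (R₂.denom.differentiable.analyticAt x)
        (right_ne_zero_of_mul hx')
  obtain ⟨P, hP, G, hG, hFG⟩ := hord.exists_eq_div_polynomial hF hpoles
  by_cases hq : 1 ≤ q.natDegree
  · have h0 := hG.eq_zero_of_div_deriv_eq hP (RatFunc.num_ne_zero hR₁) hb₁ hb₂ hq hFG hode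
    refine absurd ⟨0, ?_⟩ hnc
    filter_upwards [hFG] with z hz
    rw [hz, h0, zero_div]
  · exact ⟨q.coeff 0, Polynomial.eq_C_of_natDegree_eq_zero (by omega)⟩

/-! ### Part (ii): the class `N` -/

theorem Meromorphic.deriv_sub_id {f : ℂ → ℂ} (hf : Meromorphic f) :
    MerEq (deriv fun w => f w - w) (fun z => deriv f z - 1) := by
  refine eventually_codiscrete_iff.2 fun x => ?_
  filter_upwards [(hf x).eventually_analyticAt] with z hz
  rw [deriv_fun_sub hz.differentiableAt differentiableAt_fun_id, deriv_id'']

theorem Meromorphic.sub_id {f : ℂ → ℂ} (hf : Meromorphic f) : Meromorphic fun w => f w - w :=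
  hf.sub fun _ => analyticAt_id.meromorphicAt

theorem Meromorphic.meromorphicOrderAt_eq_top {f : ℂ → ℂ} (hf : Meromorphic f) {x : ℂ}
    (h : meromorphicOrderAt f x = ⊤) (y : ℂ) : meromorphicOrderAt f y = ⊤ := by
  by_contra hy
  exact hf.meromorphicOn.meromorphicOrderAt_ne_top_of_isPreconnected isPreconnected_univ
    (mem_univ y) (mem_univ x) hy h

/-- Otherwise every point would be a multiple zero of `f'`, with order `⊤`. -/
theorem InClassN.meromorphicOrderAt_deriv_ne_top {f : ℂ → ℂ} (hf : InClassN f) (x : ℂ) :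
    meromorphicOrderAt (deriv f) x ≠ ⊤ := by
  intro hx
  refine infinite_univ (hf.finite_multiple_zeros.subset fun y _ => ?_)
  change 2 ≤ meromorphicOrderAt (deriv f) y
  rw [hf.meromorphic.deriv.meromorphicOrderAt_eq_top hx y]
  exact le_top

/-- Otherwise `f(z) = z`, and every point is fixed with derivative `1`, giving infinitely many
exceptions. -/
theorem InClassN.meromorphicOrderAt_sub_id_ne_top {f : ℂ → ℂ} (hf : InClassN f) (x : ℂ) :
    meromorphicOrderAt (fun w => f w - w) x ≠ ⊤ := by
  intro hx
  refine infinite_univ (hf.fixed_superattracting.subset fun y _ => ?_)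
  have hy := hf.meromorphic.sub_id.meromorphicOrderAt_eq_top hx y
  refine ⟨?_, fun h => ?_⟩
  · change 0 < meromorphicOrderAt _ y
    rw [hy]
    exact WithTop.coe_lt_top 0
  · have h1 : Tendsto (deriv f) (𝓝[≠] y) (𝓝 0) := tendsto_zero_of_meromorphicOrderAt_pos h.2
    have h2 : deriv f =ᶠ[𝓝[≠] y] fun _ => 1 := by
      have h3 : f =ᶠ[𝓝[≠] y] fun w => w := by
        filter_upwards [meromorphicOrderAt_eq_top_iff.1 hy] with w hw using sub_eq_zero.1 hw
      filter_upwards [h3.nhdsNE_deriv] with w hw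
      rw [hw, deriv_id'']
    exact one_ne_zero (tendsto_nhds_unique (tendsto_const_nhds.congr' h2.symm) h1)

/-- At a fixed point `f' = 0`, so `(f - z)' = -1` and `f - z` has a simple zero; so has `f'`, as its
multiple zeros are excluded. At other points both orders are `0`. -/
theorem InClassN.meromorphicOrderAt_deriv_eq {f : ℂ → ℂ} (hf : InClassN f) {x : ℂ}
    (h₁ : ¬ IsPoleOf f x) (h₂ : ¬ IsMultipleZeroOf (deriv f) x)
    (h₃ : IsFixedPointOf f x → IsSuperattracting f x)
    (h₄ : IsZeroOf (deriv f) x → IsSuperattracting f x) :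
    meromorphicOrderAt (deriv f) x = meromorphicOrderAt (fun w => f w - w) x := by
  obtain ⟨g, hg, hfg⟩ := (hf.meromorphic x).meromorphicOrderAt_nonneg_iff.1 (not_lt.1 h₁)
  have hd0 : 0 ≤ meromorphicOrderAt (deriv f) x :=
    (hf.meromorphic.deriv x).meromorphicOrderAt_nonneg_iff.2 ⟨_, hg.deriv, hfg.nhdsNE_deriv⟩
  have hk0 : 0 ≤ meromorphicOrderAt (fun w => f w - w) x := by
    refine (hf.meromorphic.sub_id x).meromorphicOrderAt_nonneg_iff.2
      ⟨_, hg.sub analyticAt_id, ?_⟩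
    filter_upwards [hfg] with w hw
    simp [hw]
  by_cases hk : IsFixedPointOf f x
  · obtain ⟨m, hm⟩ := WithTop.ne_top_iff_exists.1 (hf.meromorphicOrderAt_sub_id_ne_top x)
    obtain ⟨l, hl⟩ := WithTop.ne_top_iff_exists.1 (hf.meromorphicOrderAt_deriv_ne_top x)
    have hz : 0 < meromorphicOrderAt (deriv f) x := (h₃ hk).2
    have hk' : 0 < meromorphicOrderAt (fun w => f w - w) x := hk
    have h2 : ¬ 2 ≤ meromorphicOrderAt (deriv f) x := h₂
    have hlim : Tendsto (deriv fun w => f w - w) (𝓝[≠] x) (𝓝 (-1)) := by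
      have := (tendsto_zero_of_meromorphicOrderAt_pos hz).sub_const 1
      rw [zero_sub] at this
      exact this.congr' (EventuallyEq.symm
        (eventually_codiscrete_iff.1 hf.meromorphic.deriv_sub_id x))
    have h0 := (tendsto_ne_zero_iff_meromorphicOrderAt_eq_zero
      (hf.meromorphic.sub_id.deriv x)).1 ⟨-1, by norm_num, hlim⟩
    rw [← hm] at hk'
    rw [← hl] at hz h2
    have hm0 : 0 < m := by exact_mod_cast hk'
    have hl0 : 0 < l := by exact_mod_cast hz
    have hl2 : ¬ 2 ≤ l := fun h => h2 (WithTop.coe_le_coe.2 h)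
    rw [meromorphicOrderAt_deriv_eq_sub_one (by exact_mod_cast hm0.ne') hm.symm] at h0
    have hm1 : m - 1 = 0 := by exact_mod_cast h0
    rw [← hm, ← hl]
    congr 1
    omega
  · have h5 : ¬ IsZeroOf (deriv f) x := fun h => hk (h₄ h).1
    rw [le_antisymm (not_lt.1 h5) hd0, le_antisymm (not_lt.1 hk) hk0]

theorem exists_factorizedRational_eq_div {d : ℂ → ℤ} (hd : d.support.Finite) :
    ∃ q₁ q₂ : ℂ[X], q₁ ≠ 0 ∧ q₂ ≠ 0 ∧
      (∏ᶠ u, (· - u) ^ d u : ℂ → ℂ) =ᶠ[codiscrete ℂ] fun z => q₁.eval z / q₂.eval z := by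
  have hprod : ∀ e : ℂ → ℕ, ∏ u ∈ hd.toFinset, (Polynomial.X - Polynomial.C u) ^ e u ≠ 0 :=
    fun e => Finset.prod_ne_zero_iff.2 fun u _ => pow_ne_zero _ (Polynomial.X_sub_C_ne_zero u)
  refine ⟨_, _, hprod fun u => (d u).toNat, hprod fun u => (-d u).toNat, ?_⟩
  filter_upwards [hd.compl_mem_codiscrete] with z hz
  have hz' : ∀ u ∈ hd.toFinset, z - u ≠ 0 := fun u hu h =>
    hz (by rw [sub_eq_zero.1 h]; simpa using hu)
  rw [Function.FactorizedRational.finprod_eq_fun hd]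
  dsimp only
  rw [finprod_eq_prod_of_mulSupport_subset (s := hd.toFinset) _ fun u hu => ?_]
  · rw [Polynomial.eval_prod, Polynomial.eval_prod, ← Finset.prod_div_distrib]
    refine Finset.prod_congr rfl fun u hu => ?_
    rw [Polynomial.eval_pow, Polynomial.eval_pow, Polynomial.eval_sub, Polynomial.eval_X,
      Polynomial.eval_C, ← zpow_natCast, ← zpow_natCast, ← zpow_sub₀ (hz' u hu)]
    congr 1
    omega
  · rw [Finite.coe_toFinset]
    intro h
    refine hu ?_
    simp only [h, zpow_zero]

/-- Functions in the class `N` satisfy a first-order equation `f' = (q₁ / q₂) g (f - z)` with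
polynomials `q₁`, `q₂` and a zero-free entire function `g`. -/
theorem InClassN.exists_deriv_eq {f : ℂ → ℂ} (hf : InClassN f) :
    ∃ q₁ q₂ : ℂ[X], q₁ ≠ 0 ∧ q₂ ≠ 0 ∧ ∃ g : ℂ → ℂ, Differentiable ℂ g ∧ (∀ z, g z ≠ 0) ∧
      MerEq (deriv f) fun z => q₁.eval z / q₂.eval z * g z * (f z - z) := by
  set k : ℂ → ℂ := fun w => f w - w
  have hk : Meromorphic k := hf.meromorphic.sub_id
  have hh : Meromorphic (deriv f / k) := hf.meromorphic.deriv.div hk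
  have hord : ∀ x, meromorphicOrderAt (deriv f / k) x
      = meromorphicOrderAt (deriv f) x - meromorphicOrderAt k x :=
    fun x => meromorphicOrderAt_div (hf.meromorphic.deriv x) (hk x)
  -- Off the four exceptional sets of the class `N` the orders of `f'` and `f - z` cancel.
  have hfin : (MeromorphicOn.divisor (deriv f / k) univ).support.Finite := by
    refine (((hf.finite_poles.union hf.finite_multiple_zeros).union
      hf.fixed_superattracting).union hf.zeros_superattracting).subset fun x hx => ?_
    by_contra hx'
    simp only [mem_union, mem_ofPred_eq, not_or, not_and, not_not] at hx'
    refine hx ?_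
    rw [MeromorphicOn.divisor_apply hh.meromorphicOn (mem_univ x), hord,
      hf.meromorphicOrderAt_deriv_eq hx'.1.1.1 hx'.1.1.2 hx'.1.2 hx'.2]
    obtain ⟨m, hm⟩ := WithTop.ne_top_iff_exists.1 (hf.meromorphicOrderAt_sub_id_ne_top x)
    rw [show meromorphicOrderAt k x = m from hm.symm, ← WithTop.LinearOrderedAddCommGroup.coe_sub, sub_self]
    rfl
  have htop : ∀ u : (univ : Set ℂ), meromorphicOrderAt (deriv f / k) (u : ℂ) ≠ ⊤ := by
    intro u
    obtain ⟨m, hm⟩ := WithTop.ne_top_iff_exists.1 (hf.meromorphicOrderAt_sub_id_ne_top (u : ℂ))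
    obtain ⟨l, hl⟩ := WithTop.ne_top_iff_exists.1 (hf.meromorphicOrderAt_deriv_ne_top (u : ℂ))
    rw [hord, show meromorphicOrderAt k (u : ℂ) = m from hm.symm, ← hl, ← WithTop.LinearOrderedAddCommGroup.coe_sub]
    exact WithTop.coe_ne_top
  obtain ⟨g, hg, hg0, hgeq⟩ := hh.meromorphicOn.extract_zeros_poles htop hfin
  obtain ⟨q₁, q₂, h₁, h₂, hq⟩ := exists_factorizedRational_eq_div hfin
  refine ⟨q₁, q₂, h₁, h₂, g, fun z => (hg z (mem_univ z)).differentiableAt,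
    fun z => hg0 ⟨z, mem_univ z⟩, ?_⟩
  have hkne : ∀ᶠ z in codiscrete ℂ, k z ≠ 0 :=
    hk.meromorphicOn.eventually_codiscreteWithin_apply_ne_zero
      fun x _ => hf.meromorphicOrderAt_sub_id_ne_top x
  filter_upwards [hgeq, hq, hkne] with z e1 e2 e3
  simp only [Pi.smul_apply', Pi.div_apply, smul_eq_mul] at e1
  rw [e2, div_eq_iff e3] at e1
  exact e1

theorem InClassN.exists_deriv_eq_exp {f : ℂ → ℂ} (hf : InClassN f) :
    ∃ q₁ q₂ q₃ : ℂ[X], q₁ ≠ 0 ∧ q₂ ≠ 0 ∧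
      MerEq (deriv f) fun z =>
        q₁.eval z / q₂.eval z * Complex.exp (q₃.eval z) * (f z - z) := by
  obtain ⟨q₁, q₂, h₁, h₂, K, dK, hK, hode⟩ := hf.exists_deriv_eq
  obtain ⟨g, dg, hg⟩ := exists_eq_exp_of_differentiable dK hK
  obtain ⟨P, hP, G, hG, hfG⟩ := hf.finite_order.exists_eq_div_polynomial hf.meromorphic
    hf.finite_poles
  -- With `f = G / P`, clearing denominators in the equation gives `K H₂ = H₁` for the two functions
  -- bounded here.
  have hH₁ : HasExpGrowth fun z =>
      q₂.eval z * (deriv G z * P.eval z - G z * P.derivative.eval z) :=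
    q₂.hasExpGrowth.mul ((hG.deriv.mul P.hasExpGrowth).sub (hG.mul P.derivative.hasExpGrowth))
  have hH₂ : HasExpGrowth fun z =>
      (q₁ * P).eval z * (G z - (Polynomial.X * P).eval z) :=
    (q₁ * P).hasExpGrowth.mul (hG.sub (Polynomial.X * P).hasExpGrowth)
  have hne : ∃ z, (q₁ * P).eval z * (G z - (Polynomial.X * P).eval z) ≠ 0 := by
    by_contra! h
    refine hf.meromorphicOrderAt_sub_id_ne_top 0 (meromorphicOrderAt_eq_top_iff.2 ?_)
    filter_upwards [eventually_codiscrete_iff.1 hfG 0,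
      eventually_codiscrete_iff.1 (Polynomial.eventually_codiscrete_eval_ne_zero h₁) 0,
      eventually_codiscrete_iff.1 (Polynomial.eventually_codiscrete_eval_ne_zero hP) 0]
      with z e1 e2 e3
    have := h z
    rw [Polynomial.eval_mul, Polynomial.eval_mul, Polynomial.eval_X] at this
    rw [e1]
    field_simp
    simpa [e2, e3, mul_comm] using this
  have hKe : HasExpGrowth K := by
    refine HasExpGrowth.of_mul_eq dK hH₁ hH₂ hne (congrFun (MerEq.eq_of_continuous ?_
      (dK.continuous.mul hH₂.1.continuous) hH₁.1.continuous))
    filter_upwards [hfG, deriv_eventuallyEq_of_eq_div hP hG.1 hfG, hode,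
      Polynomial.eventually_codiscrete_eval_ne_zero hP,
      Polynomial.eventually_codiscrete_eval_ne_zero h₂] with z e1 e2 e3 e4 e5
    rw [e3, e1] at e2
    field_simp at e2
    simp only [Polynomial.eval_mul, Polynomial.eval_X]
    linear_combination e2
  rw [funext hg] at hKe
  obtain ⟨q₃, hq₃⟩ := hKe.exists_polynomial_of_exp dg
  refine ⟨q₁, q₂, q₃, h₁, h₂, ?_⟩
  simpa only [hg, hq₃] using hode

/-- `F = f - z` satisfies `F' = (q₁/q₂) e^(q₃) F - 1`, so nonconstant `q₃` would force `F = 0`, that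
is `f(z) = z`. The case `q₁ = 0` falls because `f'` does not vanish identically. -/
theorem InClassN.isConst_of_deriv_eq_exp {f : ℂ → ℂ} (hf : InClassN f) {q₁ q₂ q₃ : ℂ[X]}
    (h₂ : q₂ ≠ 0) (hode : MerEq (deriv f) fun z =>
      q₁.eval z / q₂.eval z * Complex.exp (q₃.eval z) * (f z - z)) :
    ∃ c : ℂ, q₃ = Polynomial.C c := by
  by_cases hq : 1 ≤ q₃.natDegree
  swap
  · exact ⟨q₃.coeff 0, Polynomial.eq_C_of_natDegree_eq_zero (by omega)⟩
  exfalso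
  obtain rfl | h₁ := eq_or_ne q₁ 0
  · refine hf.meromorphicOrderAt_deriv_ne_top 0 (meromorphicOrderAt_eq_top_iff.2 ?_)
    filter_upwards [eventually_codiscrete_iff.1 hode 0] with z hz
    simpa using hz
  obtain ⟨P, hP, G, hG, hfG⟩ := hf.finite_order.exists_eq_div_polynomial hf.meromorphic
    hf.finite_poles
  have hF : MerEq (fun w => f w - w) fun z => (G z - (Polynomial.X * P).eval z) / P.eval z := by
    filter_upwards [hfG, Polynomial.eventually_codiscrete_eval_ne_zero hP] with z e1 e2
    rw [e1, Polynomial.eval_mul, Polynomial.eval_X]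
    field_simp
  have h0 := (hG.sub (Polynomial.X * P).hasExpGrowth).eq_zero_of_div_deriv_eq (a₂ := -1) (b₂ := 1)
    hP h₁ h₂ one_ne_zero hq hF (by
      filter_upwards [hf.meromorphic.deriv_sub_id, hode] with z e1 e2
      rw [e1, e2]
      simp [sub_eq_add_neg])
  refine hf.meromorphicOrderAt_sub_id_ne_top 0 (meromorphicOrderAt_eq_top_iff.2 ?_)
  filter_upwards [eventually_codiscrete_iff.1 hF 0] with z hz
  rw [hz, h0, zero_div]

theorem InClassN.exists_deriv_eq_div_mul {f : ℂ → ℂ} (hf : InClassN f) :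
    ∃ q₁ q₂ : ℂ[X], q₁ ≠ 0 ∧ q₂ ≠ 0 ∧
      MerEq (deriv f) (fun z => q₁.eval z / q₂.eval z * (f z - z)) := by
  obtain ⟨q₁, q₂, q₃, h₁, h₂, hode⟩ := hf.exists_deriv_eq_exp
  obtain ⟨c, rfl⟩ := hf.isConst_of_deriv_eq_exp h₂ hode
  refine ⟨q₁ * Polynomial.C (Complex.exp c), q₂,
    mul_ne_zero h₁ (Polynomial.C_ne_zero.2 (Complex.exp_ne_zero c)), h₂, ?_⟩
  filter_upwards [hode] with z hz
  rw [hz, Polynomial.eval_mul, Polynomial.eval_C, Polynomial.eval_C]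
  ring

theorem theorem3p1 :
    (∀ (R₁ R₂ : RatFunc ℂ) (q : Polynomial ℂ) (F : ℂ → ℂ),
      R₁ ≠ 0 → Meromorphic F → (¬ ∃ c : ℂ, MerEq F (fun _ => c)) → HasFiniteOrder F →
      MerEq (deriv F) (fun z =>
        R₁.eval (RingHom.id ℂ) z * Complex.exp (q.eval z) * F z + R₂.eval (RingHom.id ℂ) z) →
      ∃ c : ℂ, q = Polynomial.C c) ∧
    (∀ f : ℂ → ℂ, InClassN f →
      (∃ q₁ q₂ : Polynomial ℂ, q₁ ≠ 0 ∧ q₂ ≠ 0 ∧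
        MerEq (deriv f) (fun z => q₁.eval z / q₂.eval z * (f z - z))) ∧
      (∀ q₁ q₂ q₃ : Polynomial ℂ, q₂ ≠ 0 →
        MerEq (deriv f) (fun z =>
          q₁.eval z / q₂.eval z * Complex.exp (q₃.eval z) * (f z - z)) →
        ∃ c : ℂ, q₃ = Polynomial.C c)) := by
  exact ⟨fun R₁ R₂ q F hR₁ hF hnc hord hode =>
      isConst_of_deriv_eq_ratFunc_mul_exp hR₁ hF hnc hord hode,
    fun f hf => ⟨hf.exists_deriv_eq_div_mul,
      fun q₁ q₂ q₃ h₂ hode => hf.isConst_of_deriv_eq_exp h₂ hode⟩⟩
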